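/- Color every edge of the complete graph $K_n$ on $n$ vertices with one of three colors. Such a coloring is a Gallai $3$-coloring if it has no rainbow triangle, that is, no triangle whose three edges have three different colors; a set $Z$ of vertices uses at most two colors if all edges with both ends in $Z$ take their colors from some two of the three colors. Let $\log$ denote the logarithm to base $2$. (a) There is an absolute constant $c>0$ such that for every integer $n\ge 1$, every Gallai $3$-coloring of $K_n$ has a set of at least $c\,n^{1/3}\log^2 n$ vertices that uses at most two colors. (b) This is tight up to a constant factor: there is an absolute constant $C>0$ such that for every integer $n\ge 2$ there is a Gallai $3$-coloring of $K_n$ in which every vertex set that uses at most two colors has at most $C\,n^{1/3}\log^2 n$ vertices. For $n\ge 4$ this coloring can be chosen so that all three colors occur. -/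

import Mathlib

/-- An edge-coloring of the complete graph on `V` is a *Gallai coloring* if it has no rainbow
triangle, that is, no triangle whose three edges receive three pairwise different colors. -/
def IsGallaiColoring {V K : Type*} (F : SimpleGraph.TopEdgeLabeling V K) : Prop :=
  ∀ (x y z : V) (hxy : (⊤ : SimpleGraph V).Adj x y) (hyz : (⊤ : SimpleGraph V).Adj y z)
    (hxz : (⊤ : SimpleGraph V).Adj x z),
    ¬ (F.get x y hxy ≠ F.get y z hyz ∧ F.get y z hyz ≠ F.get x z hxz ∧
        F.get x y hxy ≠ F.get x z hxz)

/-- A vertex set `Z` is *`S`-subchromatic* if every edge internal to `Z` takes its color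
from `S`. -/
def IsSubchromatic {V K : Type*} (F : SimpleGraph.TopEdgeLabeling V K) (S : Finset K)
    (Z : Finset V) : Prop :=
  ∀ x ∈ Z, ∀ y ∈ Z, ∀ h : (⊤ : SimpleGraph V).Adj x y, F.get x y h ∈ S

/-- A vertex set `Z` *uses at most `s` colors* if all edges internal to `Z` take their colors
from some set of at most `s` colors. -/
def UsesAtMostColors {V K : Type*} (F : SimpleGraph.TopEdgeLabeling V K) (s : ℕ)
    (Z : Finset V) : Prop :=
  ∃ S : Finset K, S.card ≤ s ∧ IsSubchromatic F S Z

/-! Lower bound. Write a_k(S) for the largest size of a subset of S without color k. The core is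
`GallaiFun.mul_gain_le_prod`: the product of the three a_k(S) is at least |S| times a gain,
eventually of order log^6 |S|, so the largest a_k has order at least n^(1/3) log^2 n. The proof is
by induction through Gallai's theorem (`GallaiFun.exists_partition`): S splits into parts with some
color c absent between them, any two parts being joined entirely in one of the other colors d, e.
Hence a_c is superadditive over all parts, a_e over parts pairwise joined in d, and a_d over parts
pairwise joined in e. If one part holds a fixed proportion of S, the cross terms in the expanded
product outweigh the change in the gain (`add_sqrt_le_mul_mul`, `mul_gain_add_le`). If all parts are
small, a weighted Ramsey bound shows that, for parts carrying half of S, a_d(S) a_e(S) exceeds the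
product for the part by a factor at least of order s^2, where s = log(|S|/|part|)
(`mul_gain_le_of_small_parts`). The gain may therefore grow only like (1 + s/D)^2 over a logarithmic
length s. But the number of parts is at most a_c, and all a_k may be assumed at most n^(2/5), so
only lengths s ≤ τ, about (2/5) log n, matter. Three successive linear levels of length τ are thus
allowed; each reaches order log n, and their squared product gives log^6 n. Upper bound. A
lexicographic product of three random two-colorings on about n^(1/3) vertices, one for each pair of
colors: avoiding a color costs nothing in one factor and forces a logarithmic monochromatic set in
the other two. -/

/-! ### Largest sets avoiding one color -/

/-- A symmetric coloring function without rainbow triangles. -/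
structure GallaiFun {V K : Type*} (col : V → V → K) : Prop where
  symm : ∀ x y, col x y = col y x
  not_rainbow : ∀ x y z, x ≠ y → y ≠ z → x ≠ z →
    ¬ (col x y ≠ col y z ∧ col y z ≠ col x z ∧ col x y ≠ col x z)

/-- No edge inside `Z` has color `k`. -/
def AvoidsColor {V K : Type*} (col : V → V → K) (k : K) (Z : Finset V) : Prop :=
  ∀ x ∈ Z, ∀ y ∈ Z, x ≠ y → col x y ≠ k

open Classical in
/-- The largest size of a subset of `S` without edges of color `k`. -/
noncomputable def avoidNum {V K : Type*} (col : V → V → K) (k : K) (S : Finset V) : ℕ :=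
  (S.powerset.filter (AvoidsColor col k)).sup Finset.card

theorem AvoidsColor.card_le_avoidNum {V K : Type*} {col : V → V → K} {k : K} {S Z : Finset V}
    (hZ : AvoidsColor col k Z) (h : Z ⊆ S) : Z.card ≤ avoidNum col k S := by
  classical
  unfold avoidNum
  exact Finset.le_sup (f := Finset.card) (by simp [h, hZ])

theorem exists_card_eq_avoidNum {V K : Type*} (col : V → V → K) (k : K) (S : Finset V) :
    ∃ Z ⊆ S, AvoidsColor col k Z ∧ Z.card = avoidNum col k S := by
  classical
  obtain ⟨Z, hZ, h⟩ := Finset.exists_mem_eq_sup (S.powerset.filter (AvoidsColor col k))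
    ⟨∅, by simp [AvoidsColor]⟩ Finset.card
  simp only [Finset.mem_filter, Finset.mem_powerset] at hZ
  exact ⟨Z, hZ.1, hZ.2, h.symm⟩

theorem avoidNum_mono {V K : Type*} (col : V → V → K) (k : K) {S S' : Finset V} (h : S ⊆ S') :
    avoidNum col k S ≤ avoidNum col k S' := by
  obtain ⟨Z, hZ, hk, hc⟩ := exists_card_eq_avoidNum col k S
  rw [← hc]
  exact hk.card_le_avoidNum (hZ.trans h)

theorem avoidNum_pos {V K : Type*} (col : V → V → K) (k : K) {S : Finset V} (h : S.Nonempty) :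
    0 < avoidNum col k S := by
  obtain ⟨x, hx⟩ := h
  have : AvoidsColor col k {x} := by simp [AvoidsColor]
  exact lt_of_lt_of_le (by simp) (this.card_le_avoidNum (Finset.singleton_subset_iff.2 hx))

/-- Optimal subsets of the parts can be united, since color `k` does not run between parts. -/
theorem sum_avoidNum_le {V K ι : Type*} {col : V → V → K} {k : K}
    {S : Finset V} {I : Finset ι} {P : ι → Finset V} (hP : ∀ i ∈ I, P i ⊆ S)
    (hd : ∀ i ∈ I, ∀ j ∈ I, i ≠ j → Disjoint (P i) (P j))
    (hk : ∀ i ∈ I, ∀ j ∈ I, i ≠ j → ∀ x ∈ P i, ∀ y ∈ P j, col x y ≠ k) :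
    ∑ i ∈ I, avoidNum col k (P i) ≤ avoidNum col k S := by
  classical
  choose Z hZ hZk hZc using fun i => exists_card_eq_avoidNum col k (P i)
  have hdisj : (I : Set ι).PairwiseDisjoint Z := fun i hi j hj hij =>
    (hd i hi j hj hij).mono (hZ i) (hZ j)
  have : AvoidsColor col k (I.biUnion Z) := by
    intro x hx y hy hxy
    obtain ⟨i, hi, hxi⟩ := Finset.mem_biUnion.1 hx
    obtain ⟨j, hj, hyj⟩ := Finset.mem_biUnion.1 hy
    by_cases hij : i = j
    · subst hij
      exact hZk i x hxi y hyj hxy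
    · exact hk i hi j hj hij x (hZ i hxi) y (hZ j hyj)
  calc ∑ i ∈ I, avoidNum col k (P i) = (I.biUnion Z).card := by
        rw [Finset.card_biUnion hdisj]; exact Finset.sum_congr rfl fun i _ => (hZc i).symm
    _ ≤ _ := this.card_le_avoidNum
        (Finset.biUnion_subset.2 fun i hi => (hZ i).trans (hP i hi))

theorem avoidNum_add_le {V K : Type*} {col : V → V → K} (hs : ∀ x y, col x y = col y x) {k : K}
    {S X Y : Finset V} (hX : X ⊆ S) (hY : Y ⊆ S) (hd : Disjoint X Y)
    (hk : ∀ x ∈ X, ∀ y ∈ Y, col x y ≠ k) :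
    avoidNum col k X + avoidNum col k Y ≤ avoidNum col k S := by
  have := sum_avoidNum_le (col := col) (k := k) (S := S) (I := (Finset.univ : Finset Bool))
    (P := fun b => bif b then X else Y) (by simp [hX, hY])
    (by simp [hd, hd.symm]) (by
      simp only [Finset.mem_univ, Bool.forall_bool, true_imp_iff]
      simp only [ne_eq, not_true_eq_false, false_imp_iff, cond_true, cond_false, true_and,
        and_true]
      exact ⟨fun _ x hx y hy => by rw [hs]; exact hk y hy x hx, fun _ => hk⟩)
  simpa using this

/-! ### Gallai's partition theorem -/

/-- Two vertices are joined by a path of color `c` inside `S`. -/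
def ColorReach {V K : Type*} (col : V → V → K) (c : K) (S : Finset V) : V → V → Prop :=
  Relation.ReflTransGen fun a b => a ∈ S ∧ b ∈ S ∧ a ≠ b ∧ col a b = c

theorem ColorReach.symm {V K : Type*} {col : V → V → K} (hs : ∀ x y, col x y = col y x) {c : K}
    {S : Finset V} {u v : V} (h : ColorReach col c S u v) : ColorReach col c S v u := by
  induction h with
  | refl => exact Relation.ReflTransGen.refl
  | tail _ hab ih =>
    obtain ⟨ha, hb, hne, hc⟩ := hab
    exact Relation.ReflTransGen.head ⟨hb, ha, hne.symm, by rw [hs, hc]⟩ ih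

theorem ne_color_of_not_colorReach {V K : Type*} {col : V → V → K} {c : K}
    {S : Finset V} {u v : V} (hu : u ∈ S) (hv : v ∈ S) (h : ¬ ColorReach col c S u v) :
    u ≠ v ∧ col u v ≠ c := by
  have hne : u ≠ v := by
    rintro rfl
    exact h Relation.ReflTransGen.refl
  exact ⟨hne, fun hc => h (Relation.ReflTransGen.single ⟨hu, hv, hne, hc⟩)⟩

/-- A path edge `a b` has color `c`, while `w` sends `c` to neither end; the triangle `a b w` is not
rainbow, so `w` sees `a` and `b` in the same color. -/
theorem GallaiFun.eq_of_colorReach {V K : Type*} {col : V → V → K} (hG : GallaiFun col) {c : K}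
    {S : Finset V} {u v w : V} (hw : w ∈ S)
    (huv : ColorReach col c S u v) (huw : ¬ ColorReach col c S u w) : col u w = col v w := by
  induction huv with
  | refl => rfl
  | @tail a b hua hab ih =>
    obtain ⟨ha, hb, hne, hc⟩ := hab
    have haw : ¬ ColorReach col c S a w := fun h => huw (hua.trans h)
    have hbw : ¬ ColorReach col c S b w := fun h =>
      huw ((hua.tail ⟨ha, hb, hne, hc⟩).trans h)
    obtain ⟨h1, h2⟩ := ne_color_of_not_colorReach ha hw haw
    obtain ⟨h3, h4⟩ := ne_color_of_not_colorReach hb hw hbw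
    rw [ih]
    by_contra hcon
    refine hG.not_rainbow a b w hne h3 h1 ⟨?_, ?_, ?_⟩
    · rw [hc]; exact h4.symm
    · exact Ne.symm hcon
    · rw [hc]; exact h2.symm

theorem Fin.exists_other_two (c : Fin 3) :
    ∃ d e : Fin 3, c ≠ d ∧ d ≠ e ∧ c ≠ e ∧ ∀ k, k = c ∨ k = d ∨ k = e := by
  revert c; decide

/-- Induction by adding a vertex `v`. If all three colors connected `insert v S`, then `v` would
have edges of every color, and for a color `c` disconnecting `S` each `c`-component of `S` would
contain a `c`-neighbor of `v`. Two edges at `v` in the other colors then contradict each other. -/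
theorem GallaiFun.exists_not_colorReach {V : Type*} {col : V → V → Fin 3} (hG : GallaiFun col)
    (S : Finset V) (hS : 2 ≤ S.card) :
    ∃ c, ∃ u ∈ S, ∃ v ∈ S, ¬ ColorReach col c S u v := by
  classical
  induction S using Finset.induction_on with
  | empty => simp at hS
  | @insert v S hv ih =>
    by_contra! hcon
    rw [Finset.card_insert_of_notMem hv] at hS
    obtain ⟨u₀, hu₀⟩ : S.Nonempty := Finset.card_pos.1 (by omega)
    have hall : ∀ d, ∃ x ∈ S, col v x = d := by
      intro d
      rcases Relation.ReflTransGen.cases_head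
        (hcon d v (Finset.mem_insert_self _ _) u₀ (Finset.mem_insert_of_mem hu₀)) with h | h
      · exact absurd hu₀ (h ▸ hv)
      · obtain ⟨x, ⟨-, hx, hvx, hc⟩, -⟩ := h
        exact ⟨x, (Finset.mem_insert.1 hx).resolve_left hvx.symm, hc⟩
    by_cases h1 : S.card = 1
    · obtain ⟨u, rfl⟩ := Finset.card_eq_one.1 h1
      obtain ⟨x, hx, h0⟩ := hall 0
      obtain ⟨y, hy, h1⟩ := hall 1
      rw [Finset.mem_singleton] at hx hy
      rw [hx] at h0
      rw [hy, h0] at h1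
      exact absurd h1 (by decide)
    obtain ⟨c, u, hu, w, hw, huw⟩ := ih (by omega)
    have hstep : ∀ a, ColorReach col c (insert v S) a v → a ∈ S →
        ∃ a' ∈ S, ColorReach col c S a a' ∧ col v a' = c := by
      intro a ha
      induction ha using Relation.ReflTransGen.head_induction_on with
      | refl => intro h; exact absurd h hv
      | @head a b hab hbv ih' =>
        intro haS
        obtain ⟨-, hb, hne, hc⟩ := hab
        by_cases hbv' : b = v
        · subst hbv'
          exact ⟨a, haS, Relation.ReflTransGen.refl, by rw [hG.symm, hc]⟩
        · have hbS := (Finset.mem_insert.1 hb).resolve_left hbv'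
          obtain ⟨a', h1, h2, h3⟩ := ih' hbS
          exact ⟨a', h1, Relation.ReflTransGen.head ⟨haS, hbS, hne, hc⟩ h2, h3⟩
    -- With `y'` a `c`-neighbor of `v` in the component of `y`, the triangle `v x y'` has `v y'` of
    -- color `c` and its other two edges not, so these agree; the component of `y` looks uniform
    -- from `x`.
    have hcol : ∀ x ∈ S, col v x ≠ c → ∀ y ∈ S, ¬ ColorReach col c S x y →
        col x y = col v x := by
      intro x hx hxc y hy hxy
      obtain ⟨y', hy', hyy', hvy'⟩ := hstep y
        (hcon c y (Finset.mem_insert_of_mem hy) v (Finset.mem_insert_self _ _)) hy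
      have hxy' : ¬ ColorReach col c S x y' := fun h => hxy (h.trans (hyy'.symm hG.symm))
      obtain ⟨h1, h2⟩ := ne_color_of_not_colorReach hx hy' hxy'
      have h3 : col x y' = col x y := by
        rw [hG.symm x y', hG.symm x y]
        refine (hG.eq_of_colorReach hx hyy' fun h => hxy (h.symm hG.symm)).symm
      rw [← h3]
      by_contra hne
      refine hG.not_rainbow v x y' (fun h => hv (h ▸ hx)) h1 (fun h => hv (h ▸ hy'))
        ⟨Ne.symm hne, by rwa [hvy'], by rwa [hvy']⟩
    obtain ⟨d, e, hcd, hde, hce, -⟩ := Fin.exists_other_two c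
    obtain ⟨x, hx, hxd⟩ := hall d
    obtain ⟨y, hy, hye⟩ := hall e
    by_cases hxy : ColorReach col c S x y
    · obtain ⟨z, hz, hxz⟩ : ∃ z ∈ S, ¬ ColorReach col c S x z := by
        by_contra! h
        exact huw (((h u hu).symm hG.symm).trans (h w hw))
      have hyz : ¬ ColorReach col c S y z := fun h => hxz (hxy.trans h)
      have h1 := hcol x hx (by rw [hxd]; exact hcd.symm) z hz hxz
      have h2 := hcol y hy (by rw [hye]; exact hce.symm) z hz hyz
      have h3 := hG.eq_of_colorReach hz hxy hxz
      exact hde (by rw [← hxd, ← hye, ← h1, ← h2, h3])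
    · have h1 := hcol x hx (by rw [hxd]; exact hcd.symm) y hy hxy
      have h2 := hcol y hy (by rw [hye]; exact hce.symm) x hx fun h => hxy (h.symm hG.symm)
      exact hde (by rw [← hxd, ← hye, ← h1, ← h2, hG.symm])

/-- **Gallai's theorem** for three colors: `S` splits into at least two parts (the fibers of `π`)
such that color `c` does not occur between parts and any two parts are joined by one color. -/
theorem GallaiFun.exists_partition {V : Type*} {col : V → V → Fin 3} (hG : GallaiFun col)
    (S : Finset V) (hS : 2 ≤ S.card) :
    ∃ (c : Fin 3) (π : V → Set V), (∃ u ∈ S, ∃ v ∈ S, π u ≠ π v) ∧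
      (∀ u ∈ S, ∀ v ∈ S, π u ≠ π v → col u v ≠ c) ∧
      ∀ u ∈ S, ∀ u' ∈ S, ∀ v ∈ S, ∀ v' ∈ S, π u = π u' → π v = π v' → π u ≠ π v →
        col u v = col u' v' := by
  obtain ⟨c, u, hu, v, hv, huv⟩ := hG.exists_not_colorReach S hS
  have key : ∀ a b, {w | ColorReach col c S a w} = {w | ColorReach col c S b w} ↔
      ColorReach col c S a b := by
    intro a b
    constructor
    · intro h
      have : b ∈ {w | ColorReach col c S b w} := Relation.ReflTransGen.refl
      rwa [← h] at this
    · intro h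
      ext w
      exact ⟨fun h' => (h.symm hG.symm).trans h', fun h' => h.trans h'⟩
  refine ⟨c, fun a => {w | ColorReach col c S a w}, ⟨u, hu, v, hv, ?_⟩, ?_, ?_⟩
  · rwa [ne_eq, key]
  · intro a ha b hb hab
    rw [ne_eq, key] at hab
    exact (ne_color_of_not_colorReach ha hb hab).2
  · intro a ha a' ha' b hb b' hb' haa' hbb' hab
    rw [ne_eq, key] at hab
    rw [key] at haa' hbb'
    rw [hG.eq_of_colorReach hb haa' hab, hG.symm a' b, hG.symm a' b']
    refine hG.eq_of_colorReach ha' hbb' fun h => hab (haa'.trans (h.symm hG.symm))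

/-! ### A weighted Ramsey bound -/

/-- After `exp (-t) ≤ 1 / (1 + t)` the claim reduces to `1 ≤ y * z`. It closes the Ramsey recursion.
-/
theorem Real.exp_neg_add_exp_neg_le_one {y z : ℝ} (hy : 0 < y) (hz : 0 < z) (h : 1 ≤ y * z) :
    Real.exp (-y) + Real.exp (-z) ≤ 1 := by
  have aux : ∀ t : ℝ, 0 < t → Real.exp (-t) ≤ 1 / (1 + t) := by
    intro t ht
    rw [Real.exp_neg, ← one_div]
    exact one_div_le_one_div_of_le (by linarith) (by linarith [Real.add_one_le_exp t])
  calc Real.exp (-y) + Real.exp (-z) ≤ 1 / (1 + y) + 1 / (1 + z) :=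
        add_le_add (aux y hy) (aux z hz)
    _ ≤ 1 := by
        rw [div_add_div _ _ (by positivity) (by positivity), div_le_one (by positivity)]
        nlinarith

/-- The tangent line bound for the concave square root. -/
theorem Real.sqrt_sub_mul_le {B C b : ℝ} (hB : 0 < B) (hC : 0 < C) (hb : b ≤ B) :
    Real.sqrt ((B - b) * C) ≤ Real.sqrt (B * C) - b * Real.sqrt (C / B) / 2 := by
  have hx : 0 < Real.sqrt (B * C) := Real.sqrt_pos.2 (by positivity)
  have h2 : Real.sqrt (C / B) = C / Real.sqrt (B * C) := by
    rw [eq_div_iff hx.ne', ← Real.sqrt_mul (by positivity),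
      show C / B * (B * C) = C ^ 2 by field_simp, Real.sqrt_sq hC.le]
  have hsq : Real.sqrt (B * C) ^ 2 = B * C := Real.sq_sqrt (by positivity)
  have h3 : Real.sqrt (B * C) - b * Real.sqrt (C / B) / 2 =
      ((B - b) * C + B * C) / (2 * Real.sqrt (B * C)) := by
    rw [h2]; field_simp; rw [hsq]; ring
  rw [h3, le_div_iff₀ (by positivity)]
  have := Real.sq_sqrt (mul_nonneg (sub_nonneg.2 hb) hC.le)
  nlinarith [sq_nonneg (Real.sqrt ((B - b) * C) - Real.sqrt (B * C))]

/-- A weighted form of Ramsey's theorem: if every red clique has `b`-weight at most `B` and every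
blue clique has `c`-weight at most `C`, where `1 ≤ b i * c i`, there are few vertices. -/
theorem card_add_one_le_exp_of_cliques {ι : Type*} {red : ι → ι → Prop}
    (hred : ∀ i j, red i j → red j i) {b c : ι → ℝ} (I : Finset ι)
    (hb : ∀ i ∈ I, 0 < b i) (hc : ∀ i ∈ I, 0 < c i) (hbc : ∀ i ∈ I, 1 ≤ b i * c i)
    {B C : ℝ}
    (hB : ∀ K ⊆ I, (∀ i ∈ K, ∀ j ∈ K, i ≠ j → red i j) → ∑ i ∈ K, b i ≤ B)
    (hC : ∀ K ⊆ I, (∀ i ∈ K, ∀ j ∈ K, i ≠ j → ¬ red i j) → ∑ i ∈ K, c i ≤ C) :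
    (I.card : ℝ) + 1 ≤ Real.exp (2 * Real.sqrt (B * C)) := by
  classical
  induction hn : I.card using Nat.strong_induction_on generalizing I B C with
  | _ n ih =>
  subst hn
  rcases I.eq_empty_or_nonempty with rfl | ⟨x, hx⟩
  · simp
  have hbB : b x ≤ B := by
    simpa using hB {x} (by simpa using hx) (by simp)
  have hcC : c x ≤ C := by
    simpa using hC {x} (by simpa using hx) (by simp)
  have hBp : 0 < B := (hb x hx).trans_le hbB
  have hCp : 0 < C := (hc x hx).trans_le hcC
  -- The Erdős–Szekeres recursion: `x` extends every red clique of `R` and every blue clique of `Q`,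
  -- so the budgets drop by `b x` and `c x`. The `+ 1` in the statement absorbs `x`.
  set R := (I.erase x).filter (fun j => red x j) with hR
  set Q := (I.erase x).filter (fun j => ¬ red x j) with hQ
  have hRQ : R.card + Q.card + 1 = I.card := by
    rw [hR, hQ, Finset.card_filter_add_card_filter_not, Finset.card_erase_add_one hx]
  have hRI : R ⊆ I := (Finset.filter_subset _ _).trans (Finset.erase_subset _ _)
  have hQI : Q ⊆ I := (Finset.filter_subset _ _).trans (Finset.erase_subset _ _)
  have hxR : x ∉ R := by simp [hR]
  have hxQ : x ∉ Q := by simp [hQ]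
  have h1 := ih R.card (by omega) R (fun i hi => hb i (hRI hi)) (fun i hi => hc i (hRI hi))
    (fun i hi => hbc i (hRI hi)) (B := B - b x) (C := C) (by
      intro K hK hK'
      have := hB (insert x K) (Finset.insert_subset hx (hK.trans hRI)) (by
        intro i hi j hj hij
        rcases Finset.mem_insert.1 hi with rfl | hi'
        · rcases Finset.mem_insert.1 hj with rfl | hj
          · exact absurd rfl hij
          · exact (Finset.mem_filter.1 (hK hj)).2
        · rcases Finset.mem_insert.1 hj with rfl | hj
          · exact hred _ _ (Finset.mem_filter.1 (hK hi')).2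
          · exact hK' i hi' j hj hij)
      rw [Finset.sum_insert (fun h => hxR (hK h))] at this
      linarith) (fun K hK => hC K (hK.trans hRI)) rfl
  have h2 := ih Q.card (by omega) Q (fun i hi => hb i (hQI hi)) (fun i hi => hc i (hQI hi))
    (fun i hi => hbc i (hQI hi)) (B := B) (C := C - c x) (fun K hK => hB K (hK.trans hQI)) (by
      intro K hK hK'
      have := hC (insert x K) (Finset.insert_subset hx (hK.trans hQI)) (by
        intro i hi j hj hij
        rcases Finset.mem_insert.1 hi with rfl | hi'
        · rcases Finset.mem_insert.1 hj with rfl | hj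
          · exact absurd rfl hij
          · exact (Finset.mem_filter.1 (hK hj)).2
        · rcases Finset.mem_insert.1 hj with rfl | hj
          · exact fun h => (Finset.mem_filter.1 (hK hi')).2 (hred _ _ h)
          · exact hK' i hi' j hj hij)
      rw [Finset.sum_insert (fun h => hxQ (hK h))] at this
      linarith) rfl
  have e1 := Real.sqrt_sub_mul_le hBp hCp hbB
  have e2 := Real.sqrt_sub_mul_le hCp hBp hcC
  rw [mul_comm (C - c x) B, mul_comm C B] at e2
  set E := Real.exp (2 * Real.sqrt (B * C))
  set y := b x * Real.sqrt (C / B)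
  set z := c x * Real.sqrt (B / C)
  have hy : 0 < y := mul_pos (hb x hx) (Real.sqrt_pos.2 (by positivity))
  have hz : 0 < z := mul_pos (hc x hx) (Real.sqrt_pos.2 (by positivity))
  have hyz : 1 ≤ y * z := by
    have : y * z = b x * c x * (Real.sqrt (C / B) * Real.sqrt (B / C)) := by
      simp only [y, z]; ring
    rw [this, ← Real.sqrt_mul (by positivity), show C / B * (B / C) = 1 by field_simp,
      Real.sqrt_one, mul_one]
    exact hbc x hx
  have g1 : Real.exp (2 * Real.sqrt ((B - b x) * C)) ≤ E * Real.exp (-y) := by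
    rw [← Real.exp_add]; exact Real.exp_le_exp.2 (by linarith)
  have g2 : Real.exp (2 * Real.sqrt (B * (C - c x))) ≤ E * Real.exp (-z) := by
    rw [← Real.exp_add]; exact Real.exp_le_exp.2 (by linarith)
  have g3 : E * (Real.exp (-y) + Real.exp (-z)) ≤ E * 1 :=
    mul_le_mul_of_nonneg_left (Real.exp_neg_add_exp_neg_le_one hy hz hyz) (Real.exp_pos _).le
  have : (R.card : ℝ) + Q.card + 1 = I.card := by exact_mod_cast hRQ
  linarith

/-- If at most `exp (2 * v)` of the values are `≤ v`, for each `v`, then the values grow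
logarithmically. -/
theorem sum_exp_neg_le_two {ι : Type*} (v : ι → ℝ) (I : Finset ι)
    (h : ∀ i ∈ I, ((I.filter fun j => v j ≤ v i).card : ℝ) ≤ Real.exp (2 * v i)) :
    ∑ i ∈ I, Real.exp (-(4 * v i)) ≤ 2 := by
  classical
  -- A telescoping bound: the largest of `n + 1` values has `exp (2 * v) ≥ n + 1`, so its term is at
  -- most 1/(n+1)^2 ≤ 2/(n+1) - 2/(n+2).
  suffices H : ∑ i ∈ I, Real.exp (-(4 * v i)) ≤ 2 - 2 / (I.card + 1 : ℝ) by
    have : (0 : ℝ) ≤ 2 / (I.card + 1 : ℝ) := by positivity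
    linarith
  induction hn : I.card generalizing I with
  | zero =>
    rw [Finset.card_eq_zero] at hn
    subst hn
    norm_num
  | succ n ih =>
    obtain ⟨x, hx, hmax⟩ := Finset.exists_max_image I v (Finset.card_pos.1 (by omega))
    have hcard : (I.erase x).card = n := by rw [Finset.card_erase_of_mem hx]; omega
    have h1 := ih (I.erase x) (fun i hi => by
      refine le_trans ?_ (h i (Finset.mem_of_mem_erase hi))
      exact_mod_cast Finset.card_le_card (Finset.filter_subset_filter _ (Finset.erase_subset _ _)))
      hcard
    rw [← Finset.sum_erase_add _ _ hx]
    have h2 := h x hx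
    rw [Finset.filter_true_of_mem hmax, hn] at h2
    have h3 : Real.exp (-(4 * v x)) ≤ 1 / ((n : ℝ) + 1) ^ 2 := by
      rw [Real.exp_neg, ← one_div]
      apply one_div_le_one_div_of_le (by positivity)
      rw [show 4 * v x = 2 * v x + 2 * v x by ring, Real.exp_add, ← pow_two]
      push_cast at h2
      gcongr
    have h4 : 1 / ((n : ℝ) + 1) ^ 2 ≤ 2 / ((n : ℝ) + 1) - 2 / ((n : ℝ) + 2) := by
      rw [div_sub_div _ _ (by positivity) (by positivity),
        div_le_div_iff₀ (by positivity) (by positivity)]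
      have : (0 : ℝ) ≤ n := n.cast_nonneg
      nlinarith [mul_nonneg this this]
    push_cast
    rw [show (n : ℝ) + 1 + 1 = n + 2 by ring]
    linarith

/-! ### The growth function -/

/-- The logarithmic growth factor: three linear pieces of length `τ`, used one after another. -/
noncomputable def levelLog (D τ u : ℝ) : ℝ :=
  (D + max 0 (min τ u)) * (D + max 0 (min τ (u - τ))) * (D + max 0 (min τ (u - 2 * τ)))

theorem levelLog_pos {D τ : ℝ} (hD : 0 < D) (u : ℝ) : 0 < levelLog D τ u := by
  unfold levelLog
  have h : ∀ x : ℝ, 0 < D + max 0 x := fun x => by linarith [le_max_left 0 x]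
  exact mul_pos (mul_pos (h _) (h _)) (h _)

theorem sum_clamp_eq {τ : ℝ} (hτ : 0 ≤ τ) (u : ℝ) :
    max 0 (min τ u) + max 0 (min τ (u - τ)) + max 0 (min τ (u - 2 * τ)) =
      max 0 (min (3 * τ) u) := by
  have top : ∀ v : ℝ, τ ≤ v → max 0 (min τ v) = τ := fun v hv => by
    rw [min_eq_left hv, max_eq_right hτ]
  have bot : ∀ v : ℝ, v ≤ 0 → max 0 (min τ v) = 0 := fun v hv => by
    rw [min_eq_right (hv.trans hτ), max_eq_left hv]
  have mid : ∀ v : ℝ, 0 ≤ v → v ≤ τ → max 0 (min τ v) = v := fun v h0 h1 => by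
    rw [min_eq_right h1, max_eq_right h0]
  rcases le_total (3 * τ) u with h3 | h3
  · rw [top u (by linarith), top _ (by linarith), top _ (by linarith), min_eq_left h3,
      max_eq_right (by linarith)]
    ring
  rw [min_eq_right h3]
  rcases le_total u 0 with h0 | h0
  · rw [bot u h0, bot _ (by linarith), bot _ (by linarith), max_eq_left h0]
    ring
  rw [max_eq_right h0]
  rcases le_total u τ with h1 | h1
  · rw [mid u h0 h1, bot _ (by linarith), bot _ (by linarith)]
    ring
  rcases le_total u (2 * τ) with h2 | h2
  · rw [top u h1, mid _ (by linarith) (by linarith), bot _ (by linarith)]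
    ring
  · rw [top u h1, top _ (by linarith), mid _ (by linarith) (by linarith)]
    ring

/-- The three clamps add up to a single clamp of slope at most one, and every factor is at least
`D`, so the logarithm of `levelLog` has slope at most `1 / D`. -/
theorem levelLog_le_exp_mul {D τ : ℝ} (hD : 0 < D) (hτ : 0 ≤ τ) (u : ℝ) {s : ℝ} (hs : 0 ≤ s) :
    levelLog D τ u ≤ Real.exp (s / D) * levelLog D τ (u - s) := by
  have key : ∀ x y : ℝ, 0 ≤ x → x ≤ y → D + y ≤ Real.exp ((y - x) / D) * (D + x) := by
    intro x y hx hxy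
    have h1 : (y - x) / D + 1 ≤ Real.exp ((y - x) / D) := Real.add_one_le_exp _
    have h2 : D + y ≤ ((y - x) / D + 1) * (D + x) := by
      have : ((y - x) / D + 1) * (D + x) = D + y + (y - x) * x / D := by field_simp; ring
      rw [this]
      have : 0 ≤ (y - x) * x / D := div_nonneg (mul_nonneg (by linarith) hx) hD.le
      linarith
    exact h2.trans (mul_le_mul_of_nonneg_right h1 (by linarith))
  have mono : ∀ v : ℝ, max 0 (min τ (v - s)) ≤ max 0 (min τ v) := fun v =>
    max_le_max le_rfl (min_le_min le_rfl (by linarith))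
  have h0 := key _ _ (le_max_left 0 _) (mono u)
  have h1 := key _ _ (le_max_left 0 _) (mono (u - τ))
  have h2 := key _ _ (le_max_left 0 _) (mono (u - 2 * τ))
  have hsum : max 0 (min τ u) + max 0 (min τ (u - τ)) + max 0 (min τ (u - 2 * τ)) -
      (max 0 (min τ (u - s)) + max 0 (min τ (u - τ - s)) + max 0 (min τ (u - 2 * τ - s))) ≤ s := by
    have h := sum_clamp_eq hτ (u - s)
    rw [sub_right_comm u s τ, sub_right_comm u s (2 * τ)] at h
    rw [sum_clamp_eq hτ, h, sub_le_iff_le_add]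
    refine max_le (by linarith [le_max_left 0 (min (3 * τ) (u - s))]) ?_
    refine le_trans ?_ (add_le_add_right (le_max_right _ _) s)
    rw [← sub_le_iff_le_add']
    exact le_min (by linarith [min_le_left (3 * τ) u]) (by linarith [min_le_right (3 * τ) u])
  have hp : ∀ x : ℝ, 0 ≤ D + max 0 x := fun x => by linarith [le_max_left 0 x]
  unfold levelLog
  calc _ ≤ _ := mul_le_mul (mul_le_mul h0 h1 (hp _) (mul_nonneg (Real.exp_pos _).le (hp _))) h2
        (hp _) (by have := hp; positivity)
    _ = Real.exp ((max 0 (min τ u) + max 0 (min τ (u - τ)) + max 0 (min τ (u - 2 * τ)) -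
      (max 0 (min τ (u - s)) + max 0 (min τ (u - τ - s)) + max 0 (min τ (u - 2 * τ - s)))) / D) *
      ((D + max 0 (min τ (u - s))) * (D + max 0 (min τ (u - s - τ))) *
        (D + max 0 (min τ (u - s - 2 * τ)))) := by
        rw [sub_right_comm u s τ, sub_right_comm u s (2 * τ)]
        rw [show ∀ a b c x y z : ℝ, (a + b + c - (x + y + z)) / D =
          (a - x) / D + (b - y) / D + (c - z) / D from fun a b c x y z => by ring]
        rw [Real.exp_add, Real.exp_add]
        ring
    _ ≤ _ := by
        apply mul_le_mul_of_nonneg_right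
        · exact Real.exp_le_exp.2 (div_le_div_of_nonneg_right hsum hD.le)
        · exact mul_nonneg (mul_nonneg (hp _) (hp _)) (hp _)

theorem levelLog_mono {D τ : ℝ} (hD : 0 < D) {u v : ℝ} (h : u ≤ v) :
    levelLog D τ u ≤ levelLog D τ v := by
  unfold levelLog
  have hp : ∀ x : ℝ, 0 ≤ D + max 0 x := fun x => by linarith [le_max_left 0 x]
  have := hp
  gcongr

/-- Only one level rises at a time, so a window of length `s ≤ τ` meets at most two of them and the
growth stays linear in `s`, although the product has three factors. -/
theorem levelLog_le_one_add_mul {D τ : ℝ} (hD : 0 < D) (u : ℝ) {s : ℝ} (hs : 0 ≤ s)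
    (hsτ : s ≤ τ) : levelLog D τ u ≤ (1 + s / D) * levelLog D τ (u - s) := by
  suffices H : ∀ u ≤ 3 * τ, D * levelLog D τ u ≤ (D + s) * levelLog D τ (u - s) by
    have h1 := H (min u (3 * τ)) (min_le_right _ _)
    have h2 : levelLog D τ (min u (3 * τ)) = levelLog D τ u := by
      rcases le_total u (3 * τ) with h | h
      · rw [min_eq_left h]
      · rw [min_eq_right h]
        unfold levelLog
        rw [min_eq_left (by linarith), min_eq_left (by linarith), min_eq_left (by linarith),
          min_eq_left (by linarith), min_eq_left (by linarith), min_eq_left (by linarith)]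
    have h3 : levelLog D τ (min u (3 * τ) - s) ≤ levelLog D τ (u - s) :=
      levelLog_mono hD (by linarith [min_le_left u (3 * τ)])
    rw [h2] at h1
    have h4 : D * levelLog D τ u ≤ D * ((1 + s / D) * levelLog D τ (u - s)) := by
      calc _ ≤ _ := h1
        _ ≤ (D + s) * levelLog D τ (u - s) := mul_le_mul_of_nonneg_left h3 (by linarith)
        _ = _ := by field_simp
    exact le_of_mul_le_mul_left h4 hD
  intro u hu
  have hτ : 0 ≤ τ := hs.trans hsτ
  have top : ∀ v : ℝ, τ ≤ v → max 0 (min τ v) = τ := fun v hv => by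
    rw [min_eq_left hv, max_eq_right hτ]
  have bot : ∀ v : ℝ, v ≤ 0 → max 0 (min τ v) = 0 := fun v hv => by
    rw [min_eq_right (hv.trans hτ), max_eq_left hv]
  have mid : ∀ v : ℝ, 0 ≤ v → v ≤ τ → max 0 (min τ v) = v := fun v h0 h1 => by
    rw [min_eq_right h1, max_eq_right h0]
  have step : ∀ x y : ℝ, 0 ≤ x → y ≤ x + s → D * (D + y) ≤ (D + s) * (D + x) := by
    intro x y hx hy
    nlinarith [mul_nonneg hs hx]
  -- The window straddles a breakpoint. Both products have factors with the same sum, and `y ≤ s ≤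
  -- τ` makes the right-hand pair more balanced.
  have cross : ∀ x y : ℝ, 0 ≤ y → y ≤ s → x = τ + y - s →
      (D + τ) * (D + y) ≤ (D + s) * (D + x) := by
    intro x y hy hys hx
    subst hx
    nlinarith [mul_nonneg (sub_nonneg.2 hys) (sub_nonneg.2 hsτ)]
  unfold levelLog
  rcases le_total u 0 with h0 | h0
  · rw [bot u h0, bot _ (by linarith), bot _ (by linarith), bot _ (by linarith),
      bot _ (by linarith), bot _ (by linarith)]
    have := step 0 0 le_rfl (by linarith)
    nlinarith [mul_le_mul_of_nonneg_right this (mul_pos hD hD).le]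
  rcases le_total u τ with h1 | h1
  · rw [mid u h0 h1, bot (u - τ) (by linarith), bot (u - 2 * τ) (by linarith),
      bot (u - s - τ) (by linarith), bot (u - s - 2 * τ) (by linarith)]
    have := step (max 0 (min τ (u - s))) u (le_max_left _ _) (by
      rw [min_eq_right (by linarith)]; linarith [le_max_right 0 (u - s)])
    nlinarith [mul_le_mul_of_nonneg_right this (mul_pos hD hD).le]
  rcases le_total u (2 * τ) with h2 | h2
  · rw [top u h1, mid (u - τ) (by linarith) (by linarith), bot (u - 2 * τ) (by linarith),
      bot (u - s - 2 * τ) (by linarith)]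
    rcases le_total (u - s) τ with h3 | h3
    · rw [mid (u - s) (by linarith) h3, bot (u - s - τ) (by linarith)]
      have := cross (u - s) (u - τ) (by linarith) (by linarith) (by ring)
      nlinarith [mul_le_mul_of_nonneg_right this (mul_pos hD hD).le]
    · rw [top (u - s) h3, mid (u - s - τ) (by linarith) (by linarith)]
      have := step (u - s - τ) (u - τ) (by linarith) (by linarith)
      nlinarith [mul_le_mul_of_nonneg_right this
        (mul_nonneg (by linarith : 0 ≤ D + τ) hD.le)]
  · rw [top u h1, top (u - τ) (by linarith), mid (u - 2 * τ) (by linarith) (by linarith),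
      top (u - s) (by linarith)]
    rcases le_total (u - s) (2 * τ) with h3 | h3
    · rw [mid (u - s - τ) (by linarith) (by linarith), bot (u - s - 2 * τ) (by linarith)]
      have := cross (u - s - τ) (u - 2 * τ) (by linarith) (by linarith) (by ring)
      nlinarith [mul_le_mul_of_nonneg_right this
        (mul_nonneg (by linarith : 0 ≤ D + τ) hD.le)]
    · rw [top (u - s - τ) (by linarith), mid (u - s - 2 * τ) (by linarith) (by linarith)]
      have := step (u - s - 2 * τ) (u - 2 * τ) (by linarith) (by linarith)
      nlinarith [mul_le_mul_of_nonneg_right this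
        (mul_nonneg (by linarith : 0 ≤ D + τ) (by linarith : 0 ≤ D + τ))]

/-- The gain over the trivial bound `x` for sets of `x` vertices. -/
noncomputable def gain (D τ x : ℝ) : ℝ := (levelLog D τ (Real.log x) / D ^ 3) ^ 2

theorem gain_pos {D τ : ℝ} (hD : 0 < D) (x : ℝ) : 0 < gain D τ x :=
  pow_pos (div_pos (levelLog_pos hD _) (by positivity)) 2

theorem gain_le_exp_mul {D τ : ℝ} (hD : 0 < D) (hτ : 0 ≤ τ) {y q : ℝ} (hy : 0 < y) (hq : 0 < q)
    (hq1 : q ≤ 1) : Real.exp (8 / D * Real.log q) * gain D τ y ≤ gain D τ (q ^ 4 * y) := by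
  have hs : 0 ≤ -(4 * Real.log q) := by linarith [Real.log_nonpos hq.le hq1]
  have h := levelLog_le_exp_mul hD hτ (Real.log y) hs
  have h2 : Real.log y - -(4 * Real.log q) = Real.log (q ^ 4 * y) := by
    rw [Real.log_mul (by positivity) hy.ne', Real.log_pow]; push_cast; ring
  rw [h2] at h
  have h3 : gain D τ y ≤
      (Real.exp (-(4 * Real.log q) / D) * levelLog D τ (Real.log (q ^ 4 * y)) / D ^ 3) ^ 2 := by
    unfold gain
    have := (levelLog_pos (τ := τ) hD (Real.log y)).le
    gcongr
  calc _ ≤ _ := mul_le_mul_of_nonneg_left h3 (Real.exp_pos _).le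
    _ = (Real.exp (8 / D * Real.log q) * Real.exp (-(4 * Real.log q) / D) ^ 2) *
        gain D τ (q ^ 4 * y) := by unfold gain; ring
    _ = _ := by
      rw [← Real.exp_nat_mul, ← Real.exp_add]
      rw [show 8 / D * Real.log q + (2 : ℕ) * (-(4 * Real.log q) / D) = 0 by
        push_cast; ring]
      simp

theorem sq_mul_gain_le {D τ : ℝ} (hD : 4 ≤ D) (hτ : 0 ≤ τ) {y q : ℝ} (hy : 0 < y) (hq : 0 < q)
    (hq1 : q ≤ 1) : q ^ 2 * gain D τ y ≤ gain D τ (q ^ 4 * y) := by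
  refine le_trans ?_ (gain_le_exp_mul (by linarith) hτ hy hq hq1)
  apply mul_le_mul_of_nonneg_right _ (gain_pos (by linarith) _).le
  rw [← Real.exp_log (pow_pos hq 2), Real.log_pow]
  apply Real.exp_le_exp.2
  have : 8 / D ≤ 2 := by rw [div_le_iff₀ (by linarith)]; linarith
  have := mul_le_mul_of_nonpos_right this (Real.log_nonpos hq.le hq1)
  exact_mod_cast this

theorem one_add_log_mul_gain_le {D τ : ℝ} (hD : 0 < D) (hτ : 0 ≤ τ) {y q : ℝ} (hy : 0 < y)
    (hq : 0 < q) (hq1 : q ≤ 1) :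
    (1 + 8 / D * Real.log q) * gain D τ y ≤ gain D τ (q ^ 4 * y) := by
  refine le_trans ?_ (gain_le_exp_mul hD hτ hy hq hq1)
  apply mul_le_mul_of_nonneg_right _ (gain_pos hD _).le
  linarith [Real.add_one_le_exp (8 / D * Real.log q)]

theorem gain_le_one_add_sq_mul {D τ : ℝ} (hD : 0 < D) {x y : ℝ} (hx : 0 < x) (hxy : x ≤ y)
    (h : Real.log (y / x) ≤ τ) :
    gain D τ y ≤ (1 + Real.log (y / x) / D) ^ 2 * gain D τ x := by
  have hs : 0 ≤ Real.log (y / x) := Real.log_nonneg (by rwa [one_le_div hx])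
  have h1 := levelLog_le_one_add_mul hD (Real.log y) hs h
  rw [show Real.log y - Real.log (y / x) = Real.log x by
    rw [Real.log_div (by linarith) hx.ne']; ring] at h1
  unfold gain
  rw [← mul_pow, ← mul_div_assoc]
  have := (levelLog_pos (τ := τ) hD (Real.log y)).le
  gcongr

/-- A part of at least a fixed proportion compensates for the superlinearity of
`x ↦ x * gain D τ x`. -/
theorem mul_gain_add_le {D τ M : ℝ} (hM : 1 ≤ M) (hD : 5 * M ≤ D) (hτ : 0 ≤ τ)
    {x₁ x₂ x₃ : ℝ} (h1 : 0 < x₁) (h2 : 0 ≤ x₂) (h3 : 0 ≤ x₃) (hx : x₁ + x₂ + x₃ ≤ M * x₁) :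
    (x₁ + x₂ + x₃) * gain D τ (x₁ + x₂ + x₃) ≤
      x₁ * gain D τ x₁ + x₂ * gain D τ x₂ + x₃ * gain D τ x₃ +
        2 * Real.sqrt (x₁ * gain D τ x₁ * (x₂ * gain D τ x₂)) +
        2 * Real.sqrt (x₁ * gain D τ x₁ * (x₃ * gain D τ x₃)) := by
  obtain ⟨y, hy⟩ : ∃ y, y = x₁ + x₂ + x₃ := ⟨_, rfl⟩
  have hyp : 0 < y := by linarith
  have hDp : 0 < D := by linarith
  -- Proportions are written as fourth powers so that the logarithmic losses, of order `q ^ 3 / D`,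
  -- and the square-root gains, at least `q₁ ^ 3 * q ^ 3`, become comparable polynomials.
  have hroot : ∀ x, 0 ≤ x → x ≤ y → ∃ q, 0 ≤ q ∧ q ≤ 1 ∧ x = q ^ 4 * y := by
    intro x hx hxy
    refine ⟨Real.sqrt (Real.sqrt (x / y)), Real.sqrt_nonneg _, ?_, ?_⟩
    · exact Real.sqrt_le_one.2 (Real.sqrt_le_one.2 ((div_le_one hyp).2 hxy))
    · rw [show 4 = 2 * 2 from rfl, pow_mul, Real.sq_sqrt (Real.sqrt_nonneg _),
        Real.sq_sqrt (by positivity)]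
      field_simp
  obtain ⟨q₁, hq1, hq1', e1⟩ := hroot x₁ h1.le (by linarith)
  obtain ⟨q₂, hq2, hq2', e2⟩ := hroot x₂ h2 (by linarith)
  obtain ⟨q₃, hq3, hq3', e3⟩ := hroot x₃ h3 (by linarith)
  have hq1p : 0 < q₁ := by
    rcases hq1.eq_or_lt with h | h
    · rw [← h] at e1; simp at e1; linarith
    · exact h
  have hsum : q₁ ^ 4 + q₂ ^ 4 + q₃ ^ 4 = 1 := by
    have : (q₁ ^ 4 + q₂ ^ 4 + q₃ ^ 4) * y = 1 * y := by
      rw [add_mul, add_mul, ← e1, ← e2, ← e3, ← hy, one_mul]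
    exact mul_right_cancel₀ hyp.ne' this
  have hMq : 1 ≤ M * q₁ ^ 4 := by
    have : 1 * y ≤ (M * q₁ ^ 4) * y := by rw [mul_assoc, ← e1]; linarith
    exact le_of_mul_le_mul_right this hyp
  set L := y * gain D τ y with hL
  have hLp : 0 < L := mul_pos hyp (gain_pos hDp _)
  have six : ∀ q, 0 ≤ q → q ≤ 1 → L * q ^ 6 ≤ q ^ 4 * y * gain D τ (q ^ 4 * y) := by
    intro q hq hq1
    rcases hq.eq_or_lt with h | h
    · rw [← h]; simp
    · have := sq_mul_gain_le (D := D) (by linarith) hτ hyp h hq1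
      calc L * q ^ 6 = q ^ 4 * y * (q ^ 2 * gain D τ y) := by rw [hL]; ring
        _ ≤ _ := mul_le_mul_of_nonneg_left this (by positivity)
  have small : ∀ q, 0 ≤ q → q ≤ 1 →
      L * (q ^ 4 - 8 / D * q ^ 3) ≤ q ^ 4 * y * gain D τ (q ^ 4 * y) := by
    intro q hq hq1
    rcases hq.eq_or_lt with h | h
    · rw [← h]; simp
    · have := one_add_log_mul_gain_le (D := D) hDp hτ hyp h hq1
      have hlog : -q ^ 3 ≤ q ^ 4 * Real.log q := by
        have h1 := Real.one_sub_inv_le_log_of_pos h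
        have h2 := mul_le_mul_of_nonneg_left h1 (pow_pos h 4).le
        have h3 : q ^ 4 * (1 - q⁻¹) = q ^ 4 - q ^ 3 := by field_simp
        have := pow_pos h 4
        linarith
      have hlog' := mul_le_mul_of_nonneg_left hlog (by positivity : 0 ≤ 8 / D)
      calc L * (q ^ 4 - 8 / D * q ^ 3) ≤ L * (q ^ 4 * (1 + 8 / D * Real.log q)) :=
            mul_le_mul_of_nonneg_left (by linarith) hLp.le
        _ = q ^ 4 * y * ((1 + 8 / D * Real.log q) * gain D τ y) := by rw [hL]; ring
        _ ≤ _ := mul_le_mul_of_nonneg_left this (by positivity)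
  -- The large part falls short of the whole by exactly the other two proportions, so its loss is
  -- charged to `q₂` and `q₃`.
  have large : L * (q₁ ^ 4 - 2 / D * (q₂ ^ 3 + q₃ ^ 3)) ≤
      q₁ ^ 4 * y * gain D τ (q₁ ^ 4 * y) := by
    have := one_add_log_mul_gain_le (D := D) hDp hτ hyp hq1p hq1'
    have hlog : -(q₂ ^ 3 + q₃ ^ 3) ≤ q₁ ^ 4 * (4 * Real.log q₁) := by
      have h1 := Real.one_sub_inv_le_log_of_pos (pow_pos hq1p 4)
      rw [Real.log_pow] at h1
      have h2 := mul_le_mul_of_nonneg_left h1 (pow_pos hq1p 4).le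
      have h3 : q₁ ^ 4 * (1 - (q₁ ^ 4)⁻¹) = q₁ ^ 4 - 1 := by field_simp
      have h4 : q₂ ^ 4 ≤ q₂ ^ 3 := pow_le_pow_of_le_one hq2 hq2' (by norm_num)
      have h5 : q₃ ^ 4 ≤ q₃ ^ 3 := pow_le_pow_of_le_one hq3 hq3' (by norm_num)
      push_cast at h2
      linarith
    have hlog' := mul_le_mul_of_nonneg_left hlog (by positivity : 0 ≤ 2 / D)
    have e8 : 8 / D = 2 / D * 4 := by ring
    calc _ ≤ L * (q₁ ^ 4 * (1 + 8 / D * Real.log q₁)) :=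
          mul_le_mul_of_nonneg_left (by rw [e8]; linarith) hLp.le
      _ = q₁ ^ 4 * y * ((1 + 8 / D * Real.log q₁) * gain D τ y) := by rw [hL]; ring
      _ ≤ _ := mul_le_mul_of_nonneg_left this (by positivity)
  have root : ∀ q, 0 ≤ q → q ≤ 1 → L * (q₁ ^ 3 * q ^ 3) ≤
      Real.sqrt (q₁ ^ 4 * y * gain D τ (q₁ ^ 4 * y) * (q ^ 4 * y * gain D τ (q ^ 4 * y))) := by
    intro q hq hq1
    apply Real.le_sqrt_of_sq_le
    calc (L * (q₁ ^ 3 * q ^ 3)) ^ 2 = (L * q₁ ^ 6) * (L * q ^ 6) := by ring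
      _ ≤ _ := mul_le_mul (six q₁ hq1p.le hq1') (six q hq hq1) (by positivity)
        ((by positivity : 0 ≤ L * q₁ ^ 6).trans (six q₁ hq1p.le hq1'))
  have r2 := root q₂ hq2 hq2'
  have r3 := root q₃ hq3 hq3'
  have s2 := small q₂ hq2 hq2'
  have s3 := small q₃ hq3 hq3'
  rw [← hy, e1, e2, e3]
  -- The losses 8/D from a small part and 2/D from the large one are paid by the cross term; this is
  -- where `5 * M ≤ D` is needed, with `q₁ ^ 4` at least `1 / M`.
  have hcoef : 0 ≤ 2 * q₁ ^ 3 - 10 / D := by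
    have h4 : q₁ ^ 4 ≤ q₁ ^ 3 := pow_le_pow_of_le_one hq1 hq1' (by norm_num)
    have h5 : 10 / D ≤ 2 * q₁ ^ 4 := by
      rw [div_le_iff₀ hDp]
      nlinarith [mul_le_mul_of_nonneg_right hD (pow_pos hq1p 4).le]
    linarith
  have hfin : L ≤ L * (1 + (2 * q₁ ^ 3 - 10 / D) * (q₂ ^ 3 + q₃ ^ 3)) := by
    have : 0 ≤ (2 * q₁ ^ 3 - 10 / D) * (q₂ ^ 3 + q₃ ^ 3) := by positivity
    nlinarith
  have hexp : L * (1 + (2 * q₁ ^ 3 - 10 / D) * (q₂ ^ 3 + q₃ ^ 3)) =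
      L * (q₁ ^ 4 - 2 / D * (q₂ ^ 3 + q₃ ^ 3)) + L * (q₂ ^ 4 - 8 / D * q₂ ^ 3) +
      L * (q₃ ^ 4 - 8 / D * q₃ ^ 3) + 2 * (L * (q₁ ^ 3 * q₂ ^ 3)) +
      2 * (L * (q₁ ^ 3 * q₃ ^ 3)) := by
    rw [← hsum]; ring
  linarith

/-! ### The product inequality for two-color sets -/

/-- Expand the product, bounding `C` below by `c₂` next to `a₂` and `B` by `b₃` next to `a₃`. The
diagonal terms bound the `Fᵢ`; by AM-GM the pairs `a₁ * b₂ * c₁`, `a₂ * b₁ * c₂` and `a₁ * b₁ * c₃`,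
`a₃ * b₃ * c₁` bound the square roots. -/
theorem add_sqrt_le_mul_mul {a₁ a₂ a₃ b₁ b₂ b₃ c₁ c₂ c₃ A B C F₁ F₂ F₃ : ℝ}
    (ha₁ : 0 ≤ a₁) (ha₂ : 0 ≤ a₂) (ha₃ : 0 ≤ a₃) (hb₁ : 0 ≤ b₁) (hb₂ : 0 ≤ b₂) (hb₃ : 0 ≤ b₃)
    (hc₁ : 0 ≤ c₁) (hc₂ : 0 ≤ c₂) (hc₃ : 0 ≤ c₃) (hA : a₁ + a₂ + a₃ ≤ A)
    (hB : b₁ + b₂ ≤ B) (hB' : b₃ ≤ B) (hC : c₁ + c₃ ≤ C) (hC' : c₂ ≤ C)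
    (hF₂ : 0 ≤ F₂) (hF₃ : 0 ≤ F₃)
    (h₁ : F₁ ≤ a₁ * b₁ * c₁) (h₂ : F₂ ≤ a₂ * b₂ * c₂) (h₃ : F₃ ≤ a₃ * b₃ * c₃) :
    F₁ + F₂ + F₃ + 2 * Real.sqrt (F₁ * F₂) + 2 * Real.sqrt (F₁ * F₃) ≤ A * B * C := by
  have amgm : ∀ x y P : ℝ, 0 ≤ x → 0 ≤ y → P ≤ x * y → 2 * Real.sqrt P ≤ x + y := by
    intro x y P hx hy hP
    have h1 : Real.sqrt P ≤ Real.sqrt (x * y) := Real.sqrt_le_sqrt hP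
    have h2 : Real.sqrt (x * y) = Real.sqrt x * Real.sqrt y := Real.sqrt_mul hx y
    nlinarith [sq_nonneg (Real.sqrt x - Real.sqrt y), Real.sq_sqrt hx, Real.sq_sqrt hy]
  have g2 := amgm (a₁ * b₂ * c₁) (a₂ * b₁ * c₂) (F₁ * F₂) (by positivity) (by positivity) (by
    calc F₁ * F₂ ≤ (a₁ * b₁ * c₁) * (a₂ * b₂ * c₂) := mul_le_mul h₁ h₂ hF₂ (by positivity)
      _ = _ := by ring)
  have g3 := amgm (a₁ * b₁ * c₃) (a₃ * b₃ * c₁) (F₁ * F₃) (by positivity) (by positivity) (by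
    calc F₁ * F₃ ≤ (a₁ * b₁ * c₁) * (a₃ * b₃ * c₃) := mul_le_mul h₁ h₃ hF₃ (by positivity)
      _ = _ := by ring)
  have hBp : 0 ≤ B := hB'.trans' hb₃
  have hCp : 0 ≤ C := hC'.trans' hc₂
  have k1 : a₁ * ((b₁ + b₂) * (c₁ + c₃)) ≤ a₁ * (B * C) := by gcongr
  have k2 : a₂ * ((b₁ + b₂) * c₂) ≤ a₂ * (B * C) := by gcongr
  have k3 : a₃ * (b₃ * (c₁ + c₃)) ≤ a₃ * (B * C) := by gcongr
  have k4 : (a₁ + a₂ + a₃) * (B * C) ≤ A * (B * C) := by gcongr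
  have k5 : 0 ≤ a₁ * b₂ * c₃ := by positivity
  nlinarith

/-- If all parts are small, the weighted form of Ramsey's theorem gives the required gain. -/
theorem mul_gain_le_of_small_parts {ι : Type*} {red : ι → ι → Prop}
    (hred : ∀ i j, red i j → red j i) {a b c x : ι → ℝ} (I : Finset ι) (hI : I.Nonempty)
    (ha : ∀ i ∈ I, 0 < a i) (hb : ∀ i ∈ I, 0 < b i) (hc : ∀ i ∈ I, 0 < c i)
    (hx : ∀ i ∈ I, 0 < x i) {A B C D τ y : ℝ} (hA : ∑ i ∈ I, a i ≤ A)
    (hB : ∀ K ⊆ I, (∀ i ∈ K, ∀ j ∈ K, i ≠ j → red i j) → ∑ i ∈ K, b i ≤ B)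
    (hC : ∀ K ⊆ I, (∀ i ∈ K, ∀ j ∈ K, i ≠ j → ¬ red i j) → ∑ i ∈ K, c i ≤ C)
    (hy : ∑ i ∈ I, x i = y) (hsmall : ∀ i ∈ I, Real.exp 20 * x i ≤ y)
    (hD : 100 ≤ D) (hτ : Real.log (4 * I.card) ≤ τ)
    (hF : ∀ i ∈ I, x i * gain D τ (x i) ≤ a i * b i * c i) :
    y * gain D τ y ≤ A * B * C := by
  classical
  have hDp : 0 < D := by linarith
  have hyp : 0 < y := hy ▸ Finset.sum_pos hx hI
  have hbB : ∀ i ∈ I, b i ≤ B := fun i hi => by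
    simpa using hB {i} (by simpa using hi) (by simp)
  have hcC : ∀ i ∈ I, c i ≤ C := fun i hi => by
    simpa using hC {i} (by simpa using hi) (by simp)
  obtain ⟨i₀, hi₀⟩ := hI
  have hBp : 0 < B := (hb i₀ hi₀).trans_le (hbB i₀ hi₀)
  have hCp : 0 < C := (hc i₀ hi₀).trans_le (hcC i₀ hi₀)
  have hN : (0 : ℝ) < I.card := by exact_mod_cast Finset.card_pos.2 ⟨i₀, hi₀⟩
  -- The factor available for part `i` is `v i ^ 2`.
  set v : ι → ℝ := fun i => Real.sqrt (B * C / (b i * c i)) with hv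
  have hv2 : ∀ i ∈ I, v i ^ 2 * (b i * c i) = B * C := fun i hi => by
    have := mul_pos (hb i hi) (hc i hi)
    rw [hv, Real.sq_sqrt (by positivity), div_mul_cancel₀ _ this.ne']
  have hv1 : ∀ i ∈ I, 1 ≤ v i := fun i hi => by
    rw [hv, Real.one_le_sqrt, one_le_div (mul_pos (hb i hi) (hc i hi))]
    exact mul_le_mul (hbB i hi) (hcC i hi) (hc i hi).le hBp.le
  -- Dividing the red weights by `b i * c i` makes the product of the two weights at least one
  -- whenever `v j ≤ v i`, and turns the Ramsey exponent into `2 * v i`.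
  have hcount : ∀ i ∈ I, ((I.filter fun j => v j ≤ v i).card : ℝ) ≤ Real.exp (2 * v i) := by
    intro i hi
    have hs := mul_pos (hb i hi) (hc i hi)
    have hJ : (I.filter fun j => v j ≤ v i) ⊆ I := Finset.filter_subset _ _
    have := card_add_one_le_exp_of_cliques hred (b := fun j => b j / (b i * c i)) (c := c)
      (I.filter fun j => v j ≤ v i) (fun j hj => div_pos (hb j (hJ hj)) hs)
      (fun j hj => hc j (hJ hj)) (fun j hj => by
        rw [div_mul_eq_mul_div, one_le_div hs]
        have hjI := hJ hj
        have h1 : v j ≤ v i := (Finset.mem_filter.1 hj).2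
        have h2 : v j ^ 2 ≤ v i ^ 2 := pow_le_pow_left₀ (by linarith [hv1 j hjI]) h1 2
        have h3 : 0 < v j ^ 2 := pow_pos (by linarith [hv1 j hjI]) 2
        have h4 := hv2 j hjI
        have h5 := hv2 i hi
        by_contra! hlt
        have : v j ^ 2 * (b j * c j) < v j ^ 2 * (b i * c i) := mul_lt_mul_of_pos_left hlt h3
        have : v j ^ 2 * (b i * c i) ≤ v i ^ 2 * (b i * c i) :=
          mul_le_mul_of_nonneg_right h2 hs.le
        linarith)
      (B := B / (b i * c i)) (C := C) (fun K hK hK' => by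
        rw [← Finset.sum_div]
        exact div_le_div_of_nonneg_right (hB K (hK.trans hJ) hK') hs.le)
      (fun K hK hK' => hC K (hK.trans hJ) hK')
    rw [div_mul_eq_mul_div] at this
    simp only [hv] at this ⊢
    linarith
  have hexp := sum_exp_neg_le_two v I hcount
  set s : ι → ℝ := fun i => Real.log (y / x i) with hs
  have hxy : ∀ i ∈ I, x i = y * Real.exp (-s i) := fun i hi => by
    have := hx i hi
    rw [hs, Real.exp_neg, Real.exp_log (by positivity)]
    field_simp
  have hs20 : ∀ i ∈ I, 20 ≤ s i := fun i hi => by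
    have := hx i hi
    rw [hs, Real.le_log_iff_exp_le (by positivity), le_div_iff₀ this]
    exact hsmall i hi
  -- Bad parts have too small a factor to pay for the growth of the gain; as `s i ≥ 20`, they
  -- satisfy `s i ≥ 4 * v i + 3`, so their total is at most `y / 4`. Tiny parts lie outside the
  -- range `s i ≤ τ`, and also total at most `y / 4`.
  set bad := I.filter (fun i => v i < s i / 7) with hbad
  set tiny := I.filter (fun i => x i < y / (4 * I.card)) with htiny
  set good := I.filter (fun i => ¬ (v i < s i / 7) ∧ ¬ (x i < y / (4 * I.card))) with hgood
  have hbadsum : ∑ i ∈ bad, x i ≤ y / 4 := by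
    have h1 : ∀ i ∈ bad, x i ≤ y * Real.exp (-3) * Real.exp (-(4 * v i)) := by
      intro i hi
      obtain ⟨hiI, hlt⟩ := Finset.mem_filter.1 hi
      rw [hxy i hiI, mul_assoc, ← Real.exp_add]
      have := hv1 i hiI
      exact mul_le_mul_of_nonneg_left (Real.exp_le_exp.2 (by linarith)) hyp.le
    have h2 : ∑ i ∈ bad, Real.exp (-(4 * v i)) ≤ 2 :=
      (Finset.sum_le_sum_of_subset_of_nonneg (Finset.filter_subset _ _)
        fun i _ _ => (Real.exp_pos _).le).trans hexp
    have h3 : Real.exp (-3) ≤ 1 / 8 := by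
      rw [Real.exp_neg, ← one_div]
      apply one_div_le_one_div_of_le (by norm_num)
      have h : (2 : ℝ) ≤ Real.exp 1 := by linarith [Real.add_one_le_exp (1 : ℝ)]
      calc (8 : ℝ) = 2 ^ 3 := by norm_num
        _ ≤ Real.exp 1 ^ 3 := by gcongr
        _ = Real.exp 3 := by rw [← Real.exp_nat_mul]; norm_num
    calc ∑ i ∈ bad, x i ≤ ∑ i ∈ bad, y * Real.exp (-3) * Real.exp (-(4 * v i)) :=
          Finset.sum_le_sum h1
      _ = y * Real.exp (-3) * ∑ i ∈ bad, Real.exp (-(4 * v i)) := by rw [Finset.mul_sum]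
      _ ≤ y * (1 / 8) * 2 := by
        gcongr
      _ = y / 4 := by ring
  have htinysum : ∑ i ∈ tiny, x i ≤ y / 4 := by
    calc ∑ i ∈ tiny, x i ≤ ∑ _i ∈ tiny, y / (4 * I.card) :=
          Finset.sum_le_sum fun i hi => (Finset.mem_filter.1 hi).2.le
      _ ≤ ∑ _i ∈ I, y / (4 * I.card) :=
          Finset.sum_le_sum_of_subset_of_nonneg (Finset.filter_subset _ _)
            fun i _ _ => by positivity
      _ = y / 4 := by rw [Finset.sum_const, nsmul_eq_mul]; field_simp
  have hsplit : ∑ i ∈ I, x i ≤ ∑ i ∈ bad, x i + ∑ i ∈ tiny, x i + ∑ i ∈ good, x i := by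
    simp only [hbad, htiny, hgood, Finset.sum_filter, ← Finset.sum_add_distrib]
    apply Finset.sum_le_sum
    intro i hi
    have := hx i hi
    split_ifs with h1 h2 h3 <;> first | linarith | exact absurd (by tauto) h1
  have hgoodsum : y / 2 ≤ ∑ i ∈ good, x i := by linarith
  have hterm : ∀ i ∈ good, 2 * gain D τ y * x i ≤ a i * (B * C) := by
    intro i hi
    obtain ⟨hiI, h1, h2⟩ := Finset.mem_filter.1 hi
    rw [not_lt] at h1 h2
    have hxi := hx i hiI
    have hs' := hs20 i hiI
    have hle : x i ≤ y := by
      have := hsmall i hiI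
      have h : (1 : ℝ) ≤ Real.exp 20 := by linarith [Real.add_one_le_exp (20 : ℝ)]
      nlinarith
    have hsτ : Real.log (y / x i) ≤ τ := by
      refine le_trans (Real.log_le_log (by positivity) ?_) hτ
      rw [div_le_iff₀ hxi]
      have h2' := (div_le_iff₀ (mul_pos four_pos hN)).1 h2
      linarith
    have h3 := gain_le_one_add_sq_mul hDp hxi hle hsτ
    -- The factor 2 makes up for keeping only half of the total.
    have h4 : 2 * (1 + s i / D) ^ 2 ≤ v i ^ 2 := by
      have h5 : s i / D ≤ s i / 100 := by gcongr
      have h6 : 3 / 2 * (1 + s i / D) ≤ v i := by linarith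
      have h7 : 0 ≤ s i / D := by positivity
      nlinarith
    have hg := (gain_pos (τ := τ) hDp (x i)).le
    calc 2 * gain D τ y * x i ≤ 2 * ((1 + s i / D) ^ 2 * gain D τ (x i)) * x i := by gcongr
      _ = 2 * (1 + s i / D) ^ 2 * (x i * gain D τ (x i)) := by ring
      _ ≤ v i ^ 2 * (a i * b i * c i) :=
        mul_le_mul h4 (hF i hiI) (by positivity) (by positivity)
      _ = a i * (v i ^ 2 * (b i * c i)) := by ring
      _ = a i * (B * C) := by rw [hv2 i hiI]
  have hgy := gain_pos (τ := τ) hDp y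
  calc y * gain D τ y = 2 * gain D τ y * (y / 2) := by ring
    _ ≤ 2 * gain D τ y * ∑ i ∈ good, x i := by gcongr
    _ = ∑ i ∈ good, 2 * gain D τ y * x i := by rw [Finset.mul_sum]
    _ ≤ ∑ i ∈ good, a i * (B * C) := Finset.sum_le_sum hterm
    _ = (∑ i ∈ good, a i) * (B * C) := by rw [Finset.sum_mul]
    _ ≤ A * (B * C) := by
      apply mul_le_mul_of_nonneg_right _ (by positivity)
      exact (Finset.sum_le_sum_of_subset_of_nonneg (Finset.filter_subset _ _)
        fun i hi _ => (ha i hi).le).trans hA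
    _ = A * B * C := by ring

/-- The product of the three two-color numbers of a set `S` exceeds `|S|` by the factor `gain`. -/
theorem GallaiFun.mul_gain_le_prod {V : Type*} {col : V → V → Fin 3} (hG : GallaiFun col)
    {D τ T : ℝ} (hD : 5 * Real.exp 20 ≤ D) (hT : 1 ≤ T) (hτ : τ = Real.log (4 * T))
    (S : Finset V) (hS : ∀ k, (avoidNum col k S : ℝ) ≤ T) :
    (S.card : ℝ) * gain D τ S.card ≤ ∏ k, (avoidNum col k S : ℝ) := by
  classical
  have hM : (21 : ℝ) ≤ Real.exp 20 := by linarith [Real.add_one_le_exp (20 : ℝ)]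
  have hDp : 0 < D := by linarith
  have hτ0 : 0 ≤ τ := by rw [hτ]; exact Real.log_nonneg (by linarith)
  induction hn : S.card using Nat.strong_induction_on generalizing S with
  | _ n ih =>
  subst hn
  have ih' : ∀ S' ⊆ S, S'.card < S.card →
      (S'.card : ℝ) * gain D τ S'.card ≤ ∏ k, (avoidNum col k S' : ℝ) := fun S' h h' =>
    ih _ h' S' (fun k => le_trans (by exact_mod_cast avoidNum_mono col k h) (hS k)) rfl
  rcases Nat.lt_or_ge S.card 2 with h2 | h2
  · rcases Nat.lt_or_ge S.card 1 with h1 | h1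
    · have h0 : S.card = 0 := by omega
      rw [h0]
      simpa using Finset.prod_nonneg fun k _ => (avoidNum col k S).cast_nonneg
    · have h0 : S.card = 1 := by omega
      have hne : S.Nonempty := Finset.card_pos.1 h1
      -- The division by `D ^ 3` in `gain` is the normalization that starts the induction.
      have hg : gain D τ 1 = 1 := by
        unfold gain levelLog
        rw [Real.log_one, min_eq_right hτ0, min_eq_right (by linarith),
          min_eq_right (by linarith), max_eq_left le_rfl, max_eq_left (by linarith),
          max_eq_left (by linarith)]
        field_simp
        ring
      rw [h0, Nat.cast_one, hg, one_mul, ← Nat.cast_prod]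
      exact_mod_cast Finset.prod_pos fun k _ => avoidNum_pos col k hne
  obtain ⟨c, π, ⟨u₀, hu₀, v₀, hv₀, huv₀⟩, hc, hhom⟩ := hG.exists_partition S h2
  obtain ⟨d, e, hcd, hde, hce, hall⟩ := Fin.exists_other_two c
  have hprod : ∀ g : Fin 3 → ℝ, ∏ k, g k = g c * g e * g d := by
    intro g
    have : (Finset.univ : Finset (Fin 3)) = {c, e, d} := by
      ext k; simpa using by rcases hall k with h | h | h <;> simp [h]
    rw [this, Finset.prod_insert (by simp [hce, hcd]), Finset.prod_insert (by simp [hde.symm]),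
      Finset.prod_singleton, mul_assoc]
  simp only [hprod] at ih' ⊢
  set part : Set V → Finset V := fun i => S.filter (fun u => π u = i) with hpart
  set I := S.image π with hI
  have hpS : ∀ i, part i ⊆ S := fun i => Finset.filter_subset _ _
  have hmem : ∀ {i u}, u ∈ part i ↔ u ∈ S ∧ π u = i := by simp [hpart]
  have hpne : ∀ i ∈ I, (part i).Nonempty := fun i hi => by
    obtain ⟨u, hu, rfl⟩ := Finset.mem_image.1 hi
    exact ⟨u, hmem.2 ⟨hu, rfl⟩⟩
  have hpdisj : ∀ i j, i ≠ j → Disjoint (part i) (part j) := fun i j hij =>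
    Finset.disjoint_left.2 fun u hi hj => hij ((hmem.1 hi).2.symm.trans (hmem.1 hj).2)
  have hplt : ∀ i ∈ I, (part i).card < S.card := fun i _ => by
    apply Finset.card_lt_card
    refine (Finset.ssubset_iff_of_subset (hpS i)).2 ?_
    by_cases h : π u₀ = i
    · exact ⟨v₀, hv₀, fun h' => huv₀ (h.trans (hmem.1 h').2.symm)⟩
    · exact ⟨u₀, hu₀, fun h' => h (hmem.1 h').2⟩
  have hcpart : ∀ i j, i ≠ j → ∀ x ∈ part i, ∀ y ∈ part j, col x y ≠ c := by
    intro i j hij x hx y hy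
    obtain ⟨hxS, rfl⟩ := hmem.1 hx
    obtain ⟨hyS, rfl⟩ := hmem.1 hy
    exact hc x hxS y hyS hij
  -- The threshold `exp 20` serves both cases: it is the `M` of `mul_gain_add_le`, whence the bound
  -- on `D`, and it gives logarithmic ratios of at least 20 when all parts are small.
  by_cases hbig : ∃ i ∈ I, (S.card : ℝ) ≤ Real.exp 20 * (part i).card
  · obtain ⟨i, hi, hbig⟩ := hbig
    obtain ⟨x₀, hx₀, rfl⟩ := Finset.mem_image.1 hi
    set P := part (π x₀) with hP
    -- `P` is joined to `R` in color `d` and to `Q` in color `e`; between `R` and `Q` only the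
    -- absence of `c` is known.
    set R := S.filter (fun u => π u ≠ π x₀ ∧ col x₀ u = d) with hR
    set Q := S.filter (fun u => π u ≠ π x₀ ∧ col x₀ u ≠ d) with hQ
    have hRS : R ⊆ S := Finset.filter_subset _ _
    have hQS : Q ⊆ S := Finset.filter_subset _ _
    have hx₀P : x₀ ∈ P := hmem.2 ⟨hx₀, rfl⟩
    have hPR : Disjoint P R := Finset.disjoint_left.2 fun u h h' =>
      (Finset.mem_filter.1 h').2.1 (hmem.1 h).2
    have hPQ : Disjoint P Q := Finset.disjoint_left.2 fun u h h' =>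
      (Finset.mem_filter.1 h').2.1 (hmem.1 h).2
    have hRQ : Disjoint R Q := Finset.disjoint_left.2 fun u h h' =>
      (Finset.mem_filter.1 h').2.2 (Finset.mem_filter.1 h).2.2
    have hPcol : ∀ x ∈ P, ∀ u ∈ S, π u ≠ π x₀ → col x u = col x₀ u ∧ col x u ≠ c := by
      intro x hx u hu hux
      obtain ⟨hx, hxx⟩ := hmem.1 hx
      have hne : π x ≠ π u := fun h => hux (h.symm.trans hxx)
      exact ⟨hhom x hx x₀ hx₀ u hu u hu hxx rfl hne, hc x hx u hu hne⟩
    have hPRcol : ∀ x ∈ P, ∀ u ∈ R, col x u = d := fun x hx u hu => by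
      obtain ⟨hu, h1, h2⟩ := Finset.mem_filter.1 hu
      rw [(hPcol x hx u hu h1).1, h2]
    have hPQcol : ∀ x ∈ P, ∀ u ∈ Q, col x u = e := fun x hx u hu => by
      obtain ⟨hu, h1, h2⟩ := Finset.mem_filter.1 hu
      obtain ⟨h3, h4⟩ := hPcol x hx u hu h1
      rcases hall (col x u) with h | h | h
      · exact absurd h h4
      · exact absurd (h3.symm.trans h) h2
      · exact h
    have hRQcol : ∀ x ∈ R, ∀ u ∈ Q, col x u ≠ c := fun x hx u hu => by
      obtain ⟨hx, h1, h2⟩ := Finset.mem_filter.1 hx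
      obtain ⟨hu, h3, h4⟩ := Finset.mem_filter.1 hu
      refine hc x hx u hu fun h => h4 ?_
      rw [← hhom x₀ hx₀ x₀ hx₀ x hx u hu rfl h h1.symm, h2]
    have hunion : P ∪ (R ∪ Q) = S := by
      ext u
      simp only [Finset.mem_union, hP, hR, hQ, hpart, Finset.mem_filter]
      tauto
    have hcard : P.card + R.card + Q.card = S.card := by
      rw [← hunion, Finset.card_union_of_disjoint (Finset.disjoint_union_right.2 ⟨hPR, hPQ⟩),
        Finset.card_union_of_disjoint hRQ, add_assoc]
    have hPpos : 0 < P.card := Finset.card_pos.2 ⟨x₀, hx₀P⟩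
    have hcardR : (P.card : ℝ) + R.card + Q.card = S.card := by exact_mod_cast hcard
    have hA : avoidNum col c P + avoidNum col c R + avoidNum col c Q ≤ avoidNum col c S := by
      have h1 := avoidNum_add_le hG.symm (k := c) (S := R ∪ Q) Finset.subset_union_left
        Finset.subset_union_right hRQ hRQcol
      have h2 := avoidNum_add_le hG.symm (k := c) (S := S) (X := P) (Y := R ∪ Q) (hpS _)
        (Finset.union_subset hRS hQS) (Finset.disjoint_union_right.2 ⟨hPR, hPQ⟩) (by
          intro x hx u hu
          rcases Finset.mem_union.1 hu with hu | hu
          · rw [hPRcol x hx u hu]; exact hcd.symm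
          · rw [hPQcol x hx u hu]; exact hce.symm)
      omega
    have hB := avoidNum_add_le hG.symm (k := e) (hpS _) hRS hPR (fun x hx u hu => by
      rw [hPRcol x hx u hu]; exact hde)
    have hC := avoidNum_add_le hG.symm (k := d) (hpS _) hQS hPQ (fun x hx u hu => by
      rw [hPQcol x hx u hu]; exact hde.symm)
    have hfin := add_sqrt_le_mul_mul
      (Nat.cast_nonneg _) (Nat.cast_nonneg _) (Nat.cast_nonneg _)
      (Nat.cast_nonneg _) (Nat.cast_nonneg _) (Nat.cast_nonneg _)
      (Nat.cast_nonneg _) (Nat.cast_nonneg _) (Nat.cast_nonneg _)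
      (A := (avoidNum col c S : ℝ)) (by exact_mod_cast hA)
      (B := (avoidNum col e S : ℝ)) (by exact_mod_cast hB)
      (by exact_mod_cast avoidNum_mono col e hQS)
      (C := (avoidNum col d S : ℝ)) (by exact_mod_cast hC)
      (by exact_mod_cast avoidNum_mono col d hRS)
      (mul_nonneg (Nat.cast_nonneg _) (gain_pos hDp _).le)
      (mul_nonneg (Nat.cast_nonneg _) (gain_pos hDp _).le)
      (ih' P (hpS _) (hplt _ hi)) (ih' R hRS (by omega))
      (ih' Q hQS (by omega))
    refine le_trans ?_ hfin
    have := mul_gain_add_le (D := D) (τ := τ) (M := Real.exp 20) (by linarith) hD hτ0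
      (x₁ := P.card) (x₂ := R.card) (x₃ := Q.card) (by exact_mod_cast hPpos)
      (Nat.cast_nonneg _) (Nat.cast_nonneg _) (by rw [hcardR]; exact hbig)
    rwa [hcardR] at this
  · push Not at hbig
    have hred : ∀ i j, (i ≠ j ∧ ∃ u ∈ part i, ∃ v ∈ part j, col u v = d) →
        (j ≠ i ∧ ∃ u ∈ part j, ∃ v ∈ part i, col u v = d) := by
      rintro i j ⟨hij, u, hu, v, hv, huv⟩
      exact ⟨hij.symm, v, hv, u, hu, by rw [hG.symm, huv]⟩
    have hpos : ∀ k, ∀ i ∈ I, (0 : ℝ) < avoidNum col k (part i) := fun k i hi => by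
      exact_mod_cast avoidNum_pos col k (hpne i hi)
    have hA : ∑ i ∈ I, avoidNum col c (part i) ≤ avoidNum col c S :=
      sum_avoidNum_le (fun i _ => hpS i) (fun i _ j _ => hpdisj i j)
        (fun i _ j _ => hcpart i j)
    -- One vertex from each part gives a set avoiding `c`.
    have hIT : (I.card : ℝ) ≤ T := by
      refine le_trans ?_ (hS c)
      refine le_trans ?_ (Nat.cast_le.2 hA)
      rw [Finset.card_eq_sum_ones, Nat.cast_le]
      exact Finset.sum_le_sum fun i hi => avoidNum_pos col c (hpne i hi)
    have hIne : I.Nonempty := ⟨π u₀, Finset.mem_image_of_mem _ hu₀⟩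
    refine mul_gain_le_of_small_parts hred I hIne (hpos c) (hpos e) (hpos d)
      (x := fun i => (part i).card)
      (fun i hi => by exact_mod_cast Finset.card_pos.2 (hpne i hi)) (by exact_mod_cast hA)
      ?_ ?_ ?_ (fun i hi => (hbig i hi).le) (by linarith) ?_
      (fun i hi => ih' _ (hpS i) (hplt i hi))
    · intro K hK hcl
      have := sum_avoidNum_le (col := col) (k := e) (S := S) (I := K) (P := part)
        (fun i _ => hpS i) (fun i _ j _ => hpdisj i j) (by
          intro i hi j hj hij x hx y hy
          obtain ⟨-, u, hu, v, hv, huv⟩ := hcl i hi j hj hij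
          obtain ⟨huS, rfl⟩ := hmem.1 hu
          obtain ⟨hvS, rfl⟩ := hmem.1 hv
          obtain ⟨hxS, hx'⟩ := hmem.1 hx
          obtain ⟨hyS, hy'⟩ := hmem.1 hy
          rw [← hhom u huS x hxS v hvS y hyS hx'.symm hy'.symm hij, huv]
          exact hde)
      exact_mod_cast this
    · intro K hK hcl
      have := sum_avoidNum_le (col := col) (k := d) (S := S) (I := K) (P := part)
        (fun i _ => hpS i) (fun i _ j _ => hpdisj i j) (by
          intro i hi j hj hij x hx y hy hxy
          exact hcl i hi j hj hij ⟨hij, x, hx, y, hy, hxy⟩)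
      exact_mod_cast this
    · have := Finset.card_eq_sum_card_image π S
      exact_mod_cast this.symm
    · rw [hτ]
      have : (0 : ℝ) < I.card := by exact_mod_cast hIne.card_pos
      exact Real.log_le_log (by positivity) (by linarith)

/-! ### From the product to the cube root bound -/

/-- Uses log x ≤ 30 x^(1/30) and 1/3 + 2/30 = 2/5. A set of size n^(2/5) is thus already large
enough. -/
theorem rpow_third_mul_log_sq_le {x : ℝ} (hx : 1 ≤ x) :
    x ^ (1 / 3 : ℝ) * Real.log x ^ 2 ≤ 900 * x ^ (2 / 5 : ℝ) := by
  have hx0 : 0 < x := by linarith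
  have h1 := Real.log_le_rpow_div hx0.le (by norm_num : (0 : ℝ) < 1 / 30)
  have h2 : Real.log x ^ 2 ≤ (x ^ (1 / 30 : ℝ) / (1 / 30)) ^ 2 :=
    pow_le_pow_left₀ (Real.log_nonneg hx) h1 2
  have h3 : (x ^ (1 / 30 : ℝ)) ^ 2 = x ^ (1 / 15 : ℝ) := by
    rw [← Real.rpow_natCast, ← Real.rpow_mul hx0.le]; norm_num
  calc _ ≤ x ^ (1 / 3 : ℝ) * (x ^ (1 / 30 : ℝ) / (1 / 30)) ^ 2 := by gcongr
    _ = 900 * (x ^ (1 / 3 : ℝ) * x ^ (1 / 15 : ℝ)) := by rw [div_pow, h3]; ring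
    _ = _ := by rw [← Real.rpow_add hx0]; norm_num

/-- Two full levels leave (1/5) log x - 2 log 4 for the third, and `D` absorbs the constant, so all
three factors are at least (1/5) log x. -/
theorem log_pow_le_gain {D x : ℝ} (hD : 100 ≤ D) (hx : 1 ≤ x) :
    Real.log x ^ 6 / (5 * D) ^ 6 ≤ gain D (Real.log (4 * x ^ (2 / 5 : ℝ))) x := by
  have hx0 : 0 < x := by linarith
  have hl : 0 ≤ Real.log x := Real.log_nonneg hx
  have h4 : Real.log 4 ≤ 3 := by linarith [Real.log_le_sub_one_of_pos (by norm_num : (0 : ℝ) < 4)]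
  have h4' : 0 ≤ Real.log 4 := Real.log_nonneg (by norm_num)
  have hτ : Real.log (4 * x ^ (2 / 5 : ℝ)) = Real.log 4 + 2 / 5 * Real.log x := by
    rw [Real.log_mul (by norm_num) (by positivity), Real.log_rpow hx0]
  rw [hτ]
  have key : ∀ t : ℝ, Real.log x / 5 ≤ D + t → Real.log x / 5 ≤
      D + max 0 (min (Real.log 4 + 2 / 5 * Real.log x) t) := by
    intro t ht
    have : min (Real.log 4 + 2 / 5 * Real.log x) t ≤
      max 0 (min (Real.log 4 + 2 / 5 * Real.log x) t) := le_max_right _ _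
    rcases min_choice (Real.log 4 + 2 / 5 * Real.log x) t with h | h <;> rw [h] at this ⊢ <;>
      linarith
  have h : (Real.log x / 5) ^ 3 ≤ levelLog D (Real.log 4 + 2 / 5 * Real.log x) (Real.log x) := by
    unfold levelLog
    have k1 := key (Real.log x) (by linarith)
    have k2 := key (Real.log x - (Real.log 4 + 2 / 5 * Real.log x)) (by linarith)
    have k3 := key (Real.log x - 2 * (Real.log 4 + 2 / 5 * Real.log x)) (by linarith)
    calc (Real.log x / 5) ^ 3 = Real.log x / 5 * (Real.log x / 5) * (Real.log x / 5) := by ring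
      _ ≤ _ := by gcongr
  unfold gain
  calc Real.log x ^ 6 / (5 * D) ^ 6 = ((Real.log x / 5) ^ 3 / D ^ 3) ^ 2 := by
        field_simp
    _ ≤ _ := by gcongr

theorem GallaiFun.exists_large_avoidNum : ∃ c : ℝ, 0 < c ∧ ∀ n : ℕ, 1 ≤ n →
    ∀ col : Fin n → Fin n → Fin 3, GallaiFun col →
      ∃ k, c * ((n : ℝ) ^ (1 / 3 : ℝ) * Real.logb 2 (n : ℝ) ^ 2) ≤
        avoidNum col k Finset.univ := by
  obtain ⟨D, hD⟩ : ∃ D : ℝ, D = 5 * Real.exp 20 := ⟨_, rfl⟩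
  have hD1 : 100 ≤ D := by linarith [Real.add_one_le_exp (20 : ℝ)]
  obtain ⟨c, hc, hcD, hc9⟩ : ∃ c : ℝ, 0 < c ∧ c ≤ 1 / (5 * D) ^ 2 ∧ c ≤ 1 / 900 :=
    ⟨min (1 / (5 * D) ^ 2) (1 / 900), lt_min (by positivity) (by norm_num), min_le_left _ _,
      min_le_right _ _⟩
  have hlog2 : 0 < Real.log 2 := Real.log_pos (by norm_num)
  refine ⟨c * Real.log 2 ^ 2, by positivity, fun n hn col hG => ?_⟩
  have hx : (1 : ℝ) ≤ n := by exact_mod_cast hn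
  have hx0 : (0 : ℝ) < n := by linarith
  have hred : c * Real.log 2 ^ 2 * ((n : ℝ) ^ (1 / 3 : ℝ) * Real.logb 2 (n : ℝ) ^ 2) =
      c * ((n : ℝ) ^ (1 / 3 : ℝ) * Real.log n ^ 2) := by
    rw [Real.logb]; field_simp
  rw [hred]
  have hlog : 0 ≤ Real.log n := Real.log_nonneg hx
  -- The exponent 2/5 lies above 1/3, so the second case is immediate, and below 1/2, so the third
  -- level is reached.
  by_cases hT : ∀ k, (avoidNum col k Finset.univ : ℝ) ≤ (n : ℝ) ^ (2 / 5 : ℝ)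
  · have h := hG.mul_gain_le_prod (D := D) hD.ge (Real.one_le_rpow hx (by norm_num)) rfl
      Finset.univ hT
    rw [Finset.card_univ, Fintype.card_fin] at h
    by_contra! hcon
    have h1 : ∏ k, (avoidNum col k Finset.univ : ℝ) <
        ∏ _k : Fin 3, c * ((n : ℝ) ^ (1 / 3 : ℝ) * Real.log n ^ 2) := by
      have : (Finset.univ : Finset (Fin n)).Nonempty := ⟨⟨0, by omega⟩, Finset.mem_univ _⟩
      exact Finset.prod_lt_prod_of_nonempty
        (fun k _ => by exact_mod_cast avoidNum_pos col k this) (fun k _ => hcon k)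
        Finset.univ_nonempty
    rw [Finset.prod_const, Finset.card_univ, Fintype.card_fin] at h1
    have h2 := log_pow_le_gain hD1 hx
    have h3 : (c * ((n : ℝ) ^ (1 / 3 : ℝ) * Real.log n ^ 2)) ^ 3 ≤
        n * (Real.log n ^ 6 / (5 * D) ^ 6) := by
      have e1 : ((n : ℝ) ^ (1 / 3 : ℝ)) ^ 3 = n := by
        rw [← Real.rpow_natCast, ← Real.rpow_mul hx0.le]; norm_num
      calc _ = c ^ 3 * (((n : ℝ) ^ (1 / 3 : ℝ)) ^ 3 * Real.log n ^ 6) := by ring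
        _ = c ^ 3 * (n * Real.log n ^ 6) := by rw [e1]
        _ ≤ (1 / (5 * D) ^ 2) ^ 3 * (n * Real.log n ^ 6) := by gcongr
        _ = _ := by ring
    have h4 := mul_le_mul_of_nonneg_left h2 hx0.le
    linarith
  · push Not at hT
    obtain ⟨k, hk⟩ := hT
    refine ⟨k, le_trans ?_ hk.le⟩
    calc _ ≤ c * (900 * (n : ℝ) ^ (2 / 5 : ℝ)) := by
          exact mul_le_mul_of_nonneg_left (rpow_third_mul_log_sq_le hx) hc.le
      _ ≤ 1 / 900 * (900 * (n : ℝ) ^ (2 / 5 : ℝ)) := by gcongr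
      _ = _ := by ring

/-! ### Colorings with only small two-colored sets -/

theorem card_filter_forall_eq_mul_two_pow {α : Type*} [Fintype α] [DecidableEq α] (E : Finset α)
    (b : Bool) : (Finset.univ.filter fun f : α → Bool => ∀ e ∈ E, f e = b).card * 2 ^ E.card =
      2 ^ Fintype.card α := by
  have h : (Finset.univ.filter fun f : α → Bool => ∀ e ∈ E, f e = b) =
      Fintype.piFinset fun e => if e ∈ E then {b} else Finset.univ := by
    ext f
    simp only [Finset.mem_filter, Finset.mem_univ, true_and, Fintype.mem_piFinset]
    refine forall_congr' fun e => ?_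
    by_cases he : e ∈ E <;> simp [he]
  rw [h, Fintype.card_piFinset]
  have h2 : ∀ e, (if e ∈ E then ({b} : Finset Bool) else Finset.univ).card =
      if e ∈ E then 1 else 2 := fun e => by split_ifs <;> simp
  simp only [h2]
  rw [Finset.prod_ite, Finset.prod_const, Finset.prod_const, one_pow, one_mul, ← pow_add]
  congr 1
  have := Finset.card_filter_add_card_filter_not (s := (Finset.univ : Finset α)) (· ∈ E)
  rw [Finset.filter_univ_mem, Finset.card_univ] at this
  omega

/-- **Erdős' lower bound** for diagonal Ramsey numbers. -/
theorem exists_symm_without_large_mono (m L : ℕ) (hm : m ≤ 2 ^ L) :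
    ∃ r : Fin m → Fin m → Bool, (∀ x y, r x y = r y x) ∧
      ∀ b, ∀ Z : Finset (Fin m), (∀ x ∈ Z, ∀ y ∈ Z, x ≠ y → r x y = b) → Z.card < 2 * L + 3 := by
  classical
  -- Union bound: `k` vertices span `k * (L + 1)` edges, so a fixed set is monochromatic in a fixed
  -- color for a fraction 2^(-k(L+1)) of the colorings, while there are at most 2^(kL+1) pairs of a
  -- set and a color.
  set k := 2 * L + 3 with hk
  set E : Finset (Fin m) → Finset (Sym2 (Fin m)) := fun K => K.offDiag.image Sym2.mk.uncurry with hE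
  set bad : Finset (Fin m) × Bool → Finset (Sym2 (Fin m) → Bool) := fun p =>
    Finset.univ.filter fun f => ∀ e ∈ E p.1, f e = p.2 with hbad
  set J : Finset (Finset (Fin m) × Bool) :=
    (Finset.powersetCard k Finset.univ) ×ˢ Finset.univ with hJ
  set N := Fintype.card (Sym2 (Fin m)) with hN
  have hcard : ∀ p ∈ J, (bad p).card * 2 ^ (k * (L + 1)) = 2 ^ N := by
    intro p hp
    have hp1 : p.1.card = k := by
      rw [hJ, Finset.mem_product, Finset.mem_powersetCard] at hp
      exact hp.1.2
    rw [hN, ← card_filter_forall_eq_mul_two_pow (E p.1) p.2]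
    congr 2
    rw [hE, Sym2.card_image_offDiag, hp1, Nat.choose_two_right, hk,
      show 2 * L + 3 - 1 = 2 * (L + 1) by omega, mul_left_comm,
      Nat.mul_div_cancel_left _ two_pos]
  have hJcard : J.card ≤ 2 ^ (k * L + 1) := by
    rw [hJ, Finset.card_product, Finset.card_powersetCard, Finset.card_univ, Finset.card_univ,
      Fintype.card_fin, Fintype.card_bool, pow_succ]
    refine Nat.mul_le_mul_right _ ((Nat.choose_le_pow _ _).trans ?_)
    rw [mul_comm k L, pow_mul]
    exact Nat.pow_le_pow_left hm k
  have hlt : (J.biUnion bad).card < (Finset.univ : Finset (Sym2 (Fin m) → Bool)).card := by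
    have h1 : (J.biUnion bad).card * 2 ^ (k * (L + 1)) ≤ 2 ^ (k * L + 1) * 2 ^ N := by
      calc _ ≤ (∑ p ∈ J, (bad p).card) * 2 ^ (k * (L + 1)) :=
            Nat.mul_le_mul_right _ Finset.card_biUnion_le
        _ = ∑ _p ∈ J, 2 ^ N := by rw [Finset.sum_mul]; exact Finset.sum_congr rfl hcard
        _ = J.card * 2 ^ N := by rw [Finset.sum_const, smul_eq_mul]
        _ ≤ _ := Nat.mul_le_mul_right _ hJcard
    have h2 : 2 ^ (k * L + 1) * 2 ^ N < 2 ^ N * 2 ^ (k * (L + 1)) := by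
      rw [mul_comm]
      refine Nat.mul_lt_mul_of_pos_left (Nat.pow_lt_pow_right (by norm_num) ?_) (by positivity)
      rw [mul_add]; omega
    rw [Finset.card_univ, Fintype.card_fun, Fintype.card_bool, ← hN]
    exact lt_of_mul_lt_mul_right (h1.trans_lt h2) (Nat.zero_le _)
  obtain ⟨f, -, hf⟩ := Finset.exists_mem_notMem_of_card_lt_card hlt
  refine ⟨fun x y => f s(x, y), fun x y => congrArg f Sym2.eq_swap, fun b Z hZ => ?_⟩
  by_contra! hcon
  obtain ⟨K, hKZ, hKc⟩ := Finset.exists_subset_card_eq hcon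
  refine hf (Finset.mem_biUnion.2 ⟨(K, b), ?_, ?_⟩)
  · simp [hJ, Finset.mem_powersetCard, hKc]
  · simp only [hbad, Finset.mem_filter, Finset.mem_univ, true_and]
    intro e he
    obtain ⟨⟨x, y⟩, hxy, rfl⟩ := Finset.mem_image.1 he
    obtain ⟨hx, hy, hne⟩ := Finset.mem_offDiag.1 hxy
    exact hZ x (hKZ hx) y (hKZ hy) hne

/-- The lexicographic product of two colorings. -/
def lexColoring {V W K : Type*} [DecidableEq V] (f : V → V → K) (g : W → W → K) :
    V × W → V × W → K :=
  fun p q => if p.1 = q.1 then g p.2 q.2 else f p.1 q.1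

theorem GallaiFun.lexColoring {V W K : Type*} [DecidableEq V] {f : V → V → K} {g : W → W → K}
    (hf : GallaiFun f) (hg : GallaiFun g) : GallaiFun (lexColoring f g) where
  symm p q := by
    unfold _root_.lexColoring
    by_cases h : p.1 = q.1
    · rw [if_pos h, if_pos h.symm, hg.symm]
    · rw [if_neg h, if_neg (Ne.symm h), hf.symm]
  not_rainbow := by
    rintro ⟨x, x'⟩ ⟨y, y'⟩ ⟨z, z'⟩ hxy hyz hxz ⟨h1, h2, h3⟩
    simp only [_root_.lexColoring] at h1 h2 h3
    by_cases e1 : x = y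
    · subst e1
      by_cases e2 : x = z
      · subst e2
        simp only [if_true] at h1 h2 h3
        exact hg.not_rainbow x' y' z' (by rintro rfl; exact hxy rfl) (by rintro rfl; exact hyz rfl)
          (by rintro rfl; exact hxz rfl) ⟨h1, h2, h3⟩
      · simp [e2] at h2
    · by_cases e2 : y = z
      · subst e2
        simp [e1] at h3
      · by_cases e3 : x = z
        · subst e3
          simp only [e1, e2, if_false] at h1
          exact h1 (hf.symm _ _)
        · simp only [e1, e2, e3, if_false] at h1 h2 h3
          exact hf.not_rainbow x y z e1 e2 e3 ⟨h1, h2, h3⟩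

/-- The projection to `V` avoids `k` under `f`, and each fiber avoids `k` under `g`. -/
theorem AvoidsColor.card_le_mul {V W K : Type*} [DecidableEq V] {f : V → V → K}
    {g : W → W → K} {k : K} {a b : ℕ} (hf : ∀ Z, AvoidsColor f k Z → Z.card ≤ a)
    (hg : ∀ Z, AvoidsColor g k Z → Z.card ≤ b) (Z : Finset (V × W))
    (hZ : AvoidsColor (lexColoring f g) k Z) : Z.card ≤ a * b := by
  classical
  have h1 : (Z.image Prod.fst).card ≤ a := by
    apply hf
    intro x hx y hy hxy
    obtain ⟨p, hp, rfl⟩ := Finset.mem_image.1 hx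
    obtain ⟨q, hq, rfl⟩ := Finset.mem_image.1 hy
    have := hZ p hp q hq (fun h => hxy (by rw [h]))
    rwa [lexColoring, if_neg hxy] at this
  have h2 : ∀ x ∈ Z.image Prod.fst, (Z.filter fun p => p.1 = x).card ≤ b := by
    intro x _
    have hinj : Set.InjOn Prod.snd ((Z.filter fun p => p.1 = x : Finset (V × W)) : Set (V × W)) := by
      intro p hp q hq hpq
      rw [Finset.mem_coe, Finset.mem_filter] at hp hq
      exact Prod.ext (hp.2.trans hq.2.symm) hpq
    rw [← Finset.card_image_of_injOn hinj]
    apply hg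
    intro u hu v hv huv
    obtain ⟨p, hp, rfl⟩ := Finset.mem_image.1 hu
    obtain ⟨q, hq, rfl⟩ := Finset.mem_image.1 hv
    rw [Finset.mem_filter] at hp hq
    have := hZ p hp.1 q hq.1 (fun h => huv (by rw [h]))
    rwa [lexColoring, if_pos (hp.2.trans hq.2.symm)] at this
  rw [Finset.card_eq_sum_card_image Prod.fst Z]
  exact (Finset.sum_le_card_nsmul _ _ b h2).trans (by
    rw [smul_eq_mul]; exact Nat.mul_le_mul_right b h1)

/-- A symmetric two-coloring, with colors `d` and `e`. -/
def twoColoring {V K : Type*} (r : V → V → Bool) (d e : K) : V → V → K :=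
  fun x y => if r x y then d else e

theorem gallaiFun_twoColoring {V K : Type*} {r : V → V → Bool} (hr : ∀ x y, r x y = r y x)
    (d e : K) : GallaiFun (twoColoring r d e) where
  symm x y := by rw [twoColoring, twoColoring, hr]
  not_rainbow x y z _ _ _ := by
    unfold twoColoring
    cases r x y <;> cases r y z <;> cases r x z <;> simp

theorem card_le_of_avoidsColor_twoColoring {V K : Type*} {r : V → V → Bool} {s : ℕ}
    (hs : ∀ b, ∀ Z : Finset V, (∀ x ∈ Z, ∀ y ∈ Z, x ≠ y → r x y = b) → Z.card ≤ s) {d e k : K}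
    (hk : k = d ∨ k = e) (Z : Finset V) (hZ : AvoidsColor (twoColoring r d e) k Z) :
    Z.card ≤ s := by
  rcases hk with rfl | rfl
  · refine hs false Z fun x hx y hy hxy => ?_
    have := hZ x hx y hy hxy
    by_contra h
    simp [twoColoring, h] at this
  · refine hs true Z fun x hx y hy hxy => ?_
    have := hZ x hx y hy hxy
    by_contra h
    simp [twoColoring, h] at this

/-- A Gallai coloring of `m ^ 3` vertices all of whose two-colored sets are small. -/
theorem exists_gallaiFun_cube (m L : ℕ) (hm : m ≤ 2 ^ L) :
    ∃ col : (Fin m × Fin m) × Fin m → (Fin m × Fin m) × Fin m → Fin 3, GallaiFun col ∧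
      ∀ k, ∀ Z, AvoidsColor col k Z → Z.card ≤ m * (2 * L + 3) ^ 2 := by
  obtain ⟨r, hr, hmono⟩ := exists_symm_without_large_mono m L hm
  have hs := fun b Z h => (hmono b Z h).le
  have triv : ∀ (d e k : Fin 3) (Z : Finset (Fin m)), AvoidsColor (twoColoring r d e) k Z →
      Z.card ≤ m := fun _ _ _ Z _ => (Finset.card_le_univ Z).trans_eq (Fintype.card_fin m)
  have mono : ∀ (d e k : Fin 3), k = d ∨ k = e → ∀ (Z : Finset (Fin m)),
      AvoidsColor (twoColoring r d e) k Z → Z.card ≤ 2 * L + 3 := fun d e k hk =>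
    card_le_of_avoidsColor_twoColoring hs hk
  -- Each color is missing from exactly one factor, which contributes the trivial bound `m`; in the
  -- other two, avoiding it leaves one color.
  refine ⟨lexColoring (lexColoring (twoColoring r 0 1) (twoColoring r 0 2)) (twoColoring r 1 2),
    ((gallaiFun_twoColoring hr _ _).lexColoring (gallaiFun_twoColoring hr _ _)).lexColoring
      (gallaiFun_twoColoring hr _ _), fun k Z hZ => ?_⟩
  fin_cases k
  · refine (AvoidsColor.card_le_mul (AvoidsColor.card_le_mul (mono 0 1 _ (by simp))
      (mono 0 2 _ (by simp))) (triv 1 2 _) Z hZ).trans_eq (by ring)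
  · refine (AvoidsColor.card_le_mul (AvoidsColor.card_le_mul (mono 0 1 _ (by simp))
      (triv 0 2 _)) (mono 1 2 _ (by simp)) Z hZ).trans_eq (by ring)
  · refine (AvoidsColor.card_le_mul (AvoidsColor.card_le_mul (triv 0 1 _)
      (mono 0 2 _ (by simp))) (mono 1 2 _ (by simp)) Z hZ).trans_eq (by ring)

/-! ### Edge labelings and coloring functions -/

theorem UsesAtMostColors.exists_avoidsColor {V : Type*} {F : SimpleGraph.TopEdgeLabeling V (Fin 3)}
    {col : V → V → Fin 3} (hcol : ∀ x y (h : (⊤ : SimpleGraph V).Adj x y), F.get x y h = col x y)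
    {Z : Finset V} (h : UsesAtMostColors F 2 Z) : ∃ k, AvoidsColor col k Z := by
  obtain ⟨S, hS, hZ⟩ := h
  obtain ⟨k, hk⟩ : ∃ k, k ∉ S := by
    by_contra! hall
    have : S = Finset.univ := Finset.eq_univ_iff_forall.2 hall
    rw [this] at hS
    simp at hS
  refine ⟨k, fun x hx y hy hxy hc => hk ?_⟩
  have := hZ x hx y hy hxy
  rwa [hcol, hc] at this

theorem AvoidsColor.usesAtMostColors {V : Type*} {F : SimpleGraph.TopEdgeLabeling V (Fin 3)}
    {col : V → V → Fin 3} (hcol : ∀ x y (h : (⊤ : SimpleGraph V).Adj x y), F.get x y h = col x y)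
    {Z : Finset V} {k : Fin 3} (h : AvoidsColor col k Z) : UsesAtMostColors F 2 Z := by
  refine ⟨Finset.univ.erase k, by simp, fun x hx y hy hxy => ?_⟩
  rw [hcol]
  simpa using h x hx y hy hxy

theorem IsGallaiColoring.exists_gallaiFun {V : Type*} {F : SimpleGraph.TopEdgeLabeling V (Fin 3)}
    (hF : IsGallaiColoring F) : ∃ col : V → V → Fin 3, GallaiFun col ∧
      ∀ x y (h : (⊤ : SimpleGraph V).Adj x y), F.get x y h = col x y := by
  classical
  refine ⟨fun x y => if h : x ≠ y then F.get x y h else 0, ⟨fun x y => ?_, ?_⟩, ?_⟩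
  · by_cases h : x = y
    · subst h; rfl
    · rw [dif_pos h, dif_pos (Ne.symm h)]
      exact SimpleGraph.EdgeLabeling.get_comm _ _ _
  · intro x y z hxy hyz hxz
    rw [dif_pos hxy, dif_pos hyz, dif_pos hxz]
    exact hF x y z hxy hyz hxz
  · intro x y h
    exact (dif_pos (show x ≠ y from h)).symm

/-- The edge coloring given by a symmetric coloring function. -/
def GallaiFun.toLabeling {V K : Type*} {col : V → V → K} (h : GallaiFun col) :
    SimpleGraph.TopEdgeLabeling V K :=
  SimpleGraph.EdgeLabeling.mk (fun x y _ => col x y) fun x y _ => h.symm y x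

theorem GallaiFun.get_toLabeling {V K : Type*} {col : V → V → K} (h : GallaiFun col) (x y : V)
    (hxy : (⊤ : SimpleGraph V).Adj x y) : h.toLabeling.get x y hxy = col x y := rfl

theorem GallaiFun.isGallaiColoring_toLabeling {V K : Type*} {col : V → V → K}
    (h : GallaiFun col) : IsGallaiColoring h.toLabeling := by
  intro x y z hxy hyz hxz
  simp only [h.get_toLabeling]
  exact h.not_rainbow x y z hxy hyz hxz

/-! ### Tightness for every number of vertices, and the theorem -/

theorem exists_gallaiFun_small (n : ℕ) (hn : 2 ≤ n) :
    ∃ col : Fin n → Fin n → Fin 3, GallaiFun col ∧ ∀ k, ∀ Z, AvoidsColor col k Z →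
      (Z.card : ℝ) ≤ 98 * ((n : ℝ) ^ (1 / 3 : ℝ) * Real.logb 2 (n : ℝ) ^ 2) := by
  have hx : (1 : ℝ) ≤ n := by exact_mod_cast (by omega : 1 ≤ n)
  have hx0 : (0 : ℝ) < n := by linarith
  set t := (n : ℝ) ^ (1 / 3 : ℝ) with ht
  have ht1 : 1 ≤ t := Real.one_le_rpow hx (by norm_num)
  have ht3 : t ^ 3 = n := by
    rw [ht, ← Real.rpow_natCast, ← Real.rpow_mul hx0.le]; norm_num
  set m := ⌈t⌉₊ with hm
  have hm3 : n ≤ m * m * m := by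
    have : t ^ 3 ≤ (m : ℝ) ^ 3 := by gcongr; exact Nat.le_ceil t
    rw [ht3] at this
    have : n ≤ m ^ 3 := by exact_mod_cast this
    linarith [this, (by ring : m ^ 3 = m * m * m)]
  have hmt : (m : ℝ) ≤ 2 * t := by
    have := Nat.ceil_lt_add_one (by linarith : 0 ≤ t)
    linarith
  have hmn : m ≤ n := by
    refine Nat.ceil_le.2 ?_
    rw [← ht3]
    exact le_self_pow₀ ht1 (by norm_num)
  set L := Nat.log 2 n + 1 with hL
  have hmL : m ≤ 2 ^ L := hmn.trans (Nat.lt_pow_succ_log_self (by norm_num) n).le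
  have hlog : (L : ℝ) ≤ Real.logb 2 n + 1 := by
    rw [hL]
    push_cast
    have := Real.natLog_le_logb n 2
    push_cast at this
    linarith
  have hlog1 : 1 ≤ Real.logb 2 n := by
    rw [Real.le_logb_iff_rpow_le (by norm_num) hx0]
    simpa using by exact_mod_cast hn
  obtain ⟨col, hG, hcol⟩ := exists_gallaiFun_cube m L hmL
  obtain ⟨φ⟩ : Nonempty (Fin n ↪ (Fin m × Fin m) × Fin m) :=
    Function.Embedding.nonempty_of_card_le (by simpa using hm3)
  refine ⟨fun x y => col (φ x) (φ y), ⟨fun x y => hG.symm _ _, fun x y z hxy hyz hxz =>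
    hG.not_rainbow _ _ _ (φ.injective.ne hxy) (φ.injective.ne hyz) (φ.injective.ne hxz)⟩,
    fun k Z hZ => ?_⟩
  have h1 := hcol k (Z.map φ) (by
    intro x hx y hy hxy
    obtain ⟨u, hu, rfl⟩ := Finset.mem_map.1 hx
    obtain ⟨v, hv, rfl⟩ := Finset.mem_map.1 hy
    exact hZ u hu v hv fun h => hxy (by rw [h]))
  rw [Finset.card_map] at h1
  have h2 : (Z.card : ℝ) ≤ m * (2 * L + 3) ^ 2 := by exact_mod_cast h1
  calc (Z.card : ℝ) ≤ m * (2 * L + 3) ^ 2 := h2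
    -- From `L ≤ logb 2 n + 1` and `1 ≤ logb 2 n`; this is the source of 98 = 2 * 7 ^ 2.
    _ ≤ (2 * t) * (7 * Real.logb 2 n) ^ 2 := by gcongr; linarith
    _ = _ := by ring

/-- In a triangle the two edges at the lowest vertex have the same minimum. This coloring serves
small `n`, where only the occurrence of all colors is at stake. -/
theorem gallaiFun_min (n : ℕ) :
    GallaiFun fun x y : Fin n => (if min x.1 y.1 = 0 then 0 else if min x.1 y.1 = 1 then 1 else 2 :
      Fin 3) where
  symm x y := by rw [min_comm]
  not_rainbow x y z _ _ _ := by
    rintro ⟨h1, h2, h3⟩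
    have h : min x.1 y.1 = min y.1 z.1 ∨ min y.1 z.1 = min x.1 z.1 ∨
        min x.1 y.1 = min x.1 z.1 := by omega
    rcases h with h | h | h
    · exact h1 (by rw [h])
    · exact h2 (by rw [h])
    · exact h3 (by rw [h])

theorem exists_forall_rpow_third_mul_logb_sq_lt : ∃ N : ℕ, ∀ n : ℕ, N ≤ n →
    98 * ((n : ℝ) ^ (1 / 3 : ℝ) * Real.logb 2 (n : ℝ) ^ 2) < n := by
  have hlim := (tendsto_rpow_atTop (by norm_num : (0 : ℝ) < 3 / 5)).comp
    tendsto_natCast_atTop_atTop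
  obtain ⟨N, hN⟩ := Filter.eventually_atTop.1 (hlim.eventually_gt_atTop (98 * (4 * 900)))
  refine ⟨max N 1, fun n hn => ?_⟩
  have hx : (1 : ℝ) ≤ n := by exact_mod_cast (le_max_right N 1).trans hn
  have hx0 : (0 : ℝ) < n := by linarith
  have h1 : 98 * (4 * 900) < (n : ℝ) ^ (3 / 5 : ℝ) := hN n ((le_max_left N 1).trans hn)
  have h2 : (1 : ℝ) / 2 ≤ Real.log 2 := by linarith [Real.log_two_gt_d9]
  have h3 : Real.logb 2 n ≤ 2 * Real.log n := by
    rw [Real.logb, div_le_iff₀ (by linarith)]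
    nlinarith [Real.log_nonneg hx]
  have h4 : 0 ≤ Real.logb 2 n := Real.logb_nonneg (by norm_num) hx
  calc 98 * ((n : ℝ) ^ (1 / 3 : ℝ) * Real.logb 2 (n : ℝ) ^ 2)
      ≤ 98 * ((n : ℝ) ^ (1 / 3 : ℝ) * (2 * Real.log n) ^ 2) := by gcongr
    _ = 98 * (4 * ((n : ℝ) ^ (1 / 3 : ℝ) * Real.log n ^ 2)) := by ring
    _ ≤ 98 * (4 * (900 * (n : ℝ) ^ (2 / 5 : ℝ))) := by
        linarith [rpow_third_mul_log_sq_le hx]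
    _ = 98 * (4 * 900) * (n : ℝ) ^ (2 / 5 : ℝ) := by ring
    _ < (n : ℝ) ^ (3 / 5 : ℝ) * (n : ℝ) ^ (2 / 5 : ℝ) := by gcongr
    _ = n := by rw [← Real.rpow_add hx0]; norm_num

theorem theorem1 :
    -- lower bound
    (∃ c : ℝ, 0 < c ∧ ∀ n : ℕ, 1 ≤ n →
      ∀ F : SimpleGraph.TopEdgeLabeling (Fin n) (Fin 3), IsGallaiColoring F →
        ∃ Z : Finset (Fin n), UsesAtMostColors F 2 Z ∧
          c * ((n : ℝ) ^ (1 / 3 : ℝ) * Real.logb 2 (n : ℝ) ^ 2) ≤ (Z.card : ℝ)) ∧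
    -- tightness, by colorings in which (from four vertices on) all three colors occur
    (∃ C : ℝ, 0 < C ∧ ∀ n : ℕ, 2 ≤ n →
      ∃ F : SimpleGraph.TopEdgeLabeling (Fin n) (Fin 3), IsGallaiColoring F ∧
        (4 ≤ n → Function.Surjective F) ∧
        ∀ Z : Finset (Fin n), UsesAtMostColors F 2 Z →
          (Z.card : ℝ) ≤ C * ((n : ℝ) ^ (1 / 3 : ℝ) * Real.logb 2 (n : ℝ) ^ 2)) := by
  constructor
  · obtain ⟨c, hc, h⟩ := GallaiFun.exists_large_avoidNum
    refine ⟨c, hc, fun n hn F hF => ?_⟩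
    obtain ⟨col, hG, hcol⟩ := hF.exists_gallaiFun
    obtain ⟨k, hk⟩ := h n hn col hG
    obtain ⟨Z, -, hZ, hcard⟩ := exists_card_eq_avoidNum col k Finset.univ
    exact ⟨Z, hZ.usesAtMostColors hcol, by rwa [hcard]⟩
  · obtain ⟨N, hN⟩ := exists_forall_rpow_third_mul_logb_sq_lt
    -- The summand `N` makes the bound trivial for `n < N`.
    refine ⟨98 + N, by positivity, fun n hn => ?_⟩
    have hx : (1 : ℝ) ≤ n := by exact_mod_cast (by omega : 1 ≤ n)
    have hlog1 : 1 ≤ Real.logb 2 n := by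
      rw [Real.le_logb_iff_rpow_le (by norm_num) (by linarith)]
      simpa using by exact_mod_cast hn
    have hbig : 1 ≤ (n : ℝ) ^ (1 / 3 : ℝ) * Real.logb 2 (n : ℝ) ^ 2 :=
      one_le_mul_of_one_le_of_one_le (Real.one_le_rpow hx (by norm_num)) (one_le_pow₀ hlog1)
    rcases Nat.lt_or_ge n N with hnN | hnN
    · have hG := gallaiFun_min n
      refine ⟨hG.toLabeling, hG.isGallaiColoring_toLabeling, fun h4 k => ?_, fun Z _ => ?_⟩
      · have key : ∀ i j : ℕ, (hi : i < n) → (hj : j < n) → (hij : i ≠ j) →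
            ∃ e, hG.toLabeling e =
              (if min i j = 0 then 0 else if min i j = 1 then 1 else 2 : Fin 3) :=
          fun i j hi hj hij => ⟨⟨s(⟨i, hi⟩, ⟨j, hj⟩), by simpa using hij⟩, rfl⟩
        fin_cases k
        · exact key 0 1 (by omega) (by omega) (by omega)
        · exact key 1 2 (by omega) (by omega) (by omega)
        · exact key 2 3 (by omega) (by omega) (by omega)
      · have h1 : (Z.card : ℝ) ≤ N := by
          have := (Finset.card_le_univ Z).trans_eq (Fintype.card_fin n)
          exact_mod_cast this.trans hnN.le
        nlinarith [(N.cast_nonneg : (0 : ℝ) ≤ N)]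
    · obtain ⟨col, hG, hcol⟩ := exists_gallaiFun_small n hn
      refine ⟨hG.toLabeling, hG.isGallaiColoring_toLabeling, fun _ => ?_, fun Z hZ => ?_⟩
      · by_contra hsurj
        obtain ⟨k, hk⟩ : ∃ k, ∀ e, hG.toLabeling e ≠ k := by
          simpa [Function.Surjective] using hsurj
        have := hcol k Finset.univ fun x _ y _ hxy => hk ⟨s(x, y), hxy⟩
        rw [Finset.card_univ, Fintype.card_fin] at this
        linarith [hN n hnN]
      · obtain ⟨k, hk⟩ := hZ.exists_avoidsColor hG.get_toLabeling
        have := hcol k Z hk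
        nlinarith [(N.cast_nonneg : (0 : ℝ) ≤ N)]
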